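/- **Setting.** Let $\mathcal H,\mathcal H'$ be separable complex Hilbert spaces, $\tau c(\mathcal H)$ the trace-class operators ($\|A\|_1=\mathrm{tr}|A|<\infty$), and consider linear maps $\Lambda:\tau c(\mathcal H)\to\tau c(\mathcal H')$. Such a map is completely positive if $(\Lambda\otimes\mathbf I)(A)\ge 0$ for every trace-class $A\ge0$ on $\mathcal H\otimes\mathcal K$ and every ancilla $\mathcal K$ (a separable Hilbert space), and $\|\Lambda\|_{cb}=\sup\{\|(\Lambda\otimes\mathbf I)(X)\|_1:\|X\|_1=1\}$ over all ancillas. Let $\Theta\subset\mathbb R^m$ be open and $\mathcal L=\{\Lambda_\theta\}_{\theta\in\Theta}$ a family of completely positive trace-preserving maps $\tau c(\mathcal H)\to\tau c(\mathcal H')$. *Regularity of the model (CM.1).* $\partial_i\Lambda_\theta$ and $\partial_i\partial_j\Lambda_\theta$ exist for all $\theta\in\Theta$, are locally uniformly continuous in $\theta$, and $\|\partial_i\Lambda_\theta\|_{cb},\|\partial_i\partial_j\Lambda_\theta\|_{cb}\le a_1/2<\infty$ on $\Theta$; derivatives and continuity are understood in $\|\cdot\|_{cb}$. *Estimators.* An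 estimator $\mathcal E_n$ with $n\ge1$ uses of the unknown operation consists of an ancilla $\mathcal K$, a density operator $\rho^n$ on $\mathcal H\otimes\mathcal K$, completely positive trace-preserving maps $\Xi^n_1,\dots,\Xi^n_{n-1}$ from $\tau c(\mathcal H'\otimes\mathcal K)$ to $\tau c(\mathcal H\otimes\mathcal K)$, a POVM $M^n$ on $\mathcal H'\otimes\mathcal K$ with outcomes in some $\mathbb R^{l_n}$, and a measurable map $T_n:\mathbb R^{l_n}\to\mathbb R^m$. The data $\omega_n$ have distribution $$P^{\mathcal E_n}_\theta(\Delta)=\mathrm{tr}\,\big[(\Lambda_\theta\otimes\mathbf I)\circ\Xi^n_{n-1}\circ(\Lambda_\theta\otimes\mathbf I)\circ\cdots\circ\Xi^n_1\circ(\Lambda_\theta\otimes\mathbf I)\big](\rho^n)\,M^n(\Delta).$$ Write $\mathrm E_\theta$ for the expectation under $P^{\mathcal E_n}_\theta$ and $(\mathrm{MSE}_\theta[\mathcal E_n])_{ij}=\mathrm E_\theta[(T_n^i-\theta^i)(T_n^j-\theta^j)]$. A sequence $\{\mathcal E_n\}_{n\ge1}$ is *admissible* if 1. (asymptotic unbiasedness)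 for all $\theta\in\Theta$: $\lim_n\mathrm E_\theta[T_n]=\theta$, and the partial derivatives $\partial_j\mathrm E_\theta[T_n^i]$ exist with $\lim_n\partial_j\mathrm E_\theta[T_n^i]=\delta^i_j$; 2. (CE) there are $a_2>0$ and completely positive maps $\square_{i,\theta}$ ($1\le i\le m$, $\theta\in\Theta$) such that $\square_{i,\theta}-\partial_i\Lambda_{\theta_0}$ is completely positive whenever $\theta,\theta_0\in\Theta$, $\|\theta_0-\theta\|<a_2$, and for every $n\ge1$ there is $a_{4,n}<\infty$ with, for all $\theta\in\Theta$ and all $i$, $$\int\|T_n(\omega)-\theta\|\,\mathrm{tr}\,\varpi^n_{i,\theta}M^n(d\omega)\le n a_1a_{4,n},\qquad \int\|T_n(\omega)-\theta\|^2\,P^{\mathcal E_n}_\theta(d\omega)\le n\,a_{4,n}^2,$$ where $\varpi^n_{i,\theta}$ is the sum over $\kappa=1,\dots,n$ of the final states obtained when the $\kappa$-th use of $\Lambda_\theta$ is replaced by $\square_{i,\theta}$. For $\theta\in\Theta$ and a real symmetric positive semidefinite $m\times m$ matrix $G_\theta\neq0$ let $$C_\theta(G_\theta,\mathcal L)=\inf\Big\{\limsup_{n\to\infty}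 n\,\mathrm{Tr}\,G_\theta\,\mathrm{MSE}_\theta[\mathcal E_n]\;:\;\{\mathcal E_n\}\text{ admissible}\Big\}\in[0,\infty].$$ **Theorem.** Assume (CM.1), and that there is $\varepsilon>0$ such that $\Lambda_\theta+\sum_{i=1}^m u^i\,\partial_i\Lambda_\theta$ is completely positive for all $u\in\mathbb R^m$ with $\|u\|<\varepsilon$ and all $\theta\in\Theta$. Then, for every $\theta\in\Theta$ and every such $G_\theta$, $C_\theta(G_\theta,\mathcal L)\neq0$. In particular no admissible sequence satisfies $\mathrm{Tr}\,G_\theta\,\mathrm{MSE}_\theta[\mathcal E_n]=O(1/n^2)$ (no Heisenberg scaling). -/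

import Mathlib

open scoped ENNReal NNReal InnerProductSpace Topology
open Filter MeasureTheory

noncomputable section

namespace QuantumEstimation

universe u v

/-! ### Trace-class operators -/

section TraceClass

variable (E : Type u) [NormedAddCommGroup E] [InnerProductSpace ℂ E] [CompleteSpace E]

/-- The index set of a fixed complete orthonormal system of `E`. -/
def basisIndex : Set E := (exists_hilbertBasis ℂ E).choose

/-- A fixed complete orthonormal system of `E`. -/
def basis : HilbertBasis (basisIndex E) ℂ E := (exists_hilbertBasis ℂ E).choose_spec.choose

variable {E}

/-- The trace `∑ ⟨e_i, A e_i⟩ ∈ [0, ∞]` of a positive operator. -/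
def posTrace (A : E →L[ℂ] E) : ℝ≥0∞ :=
  ∑' i, ENNReal.ofReal (RCLike.re ⟪basis E i, A (basis E i)⟫_ℂ)

/-- The trace norm `‖A‖₁ = tr |A|`, with values in `[0, ∞]`. -/
def traceNorm (A : E →L[ℂ] E) : ℝ≥0∞ := posTrace (CFC.abs A)

/-- The trace `∑ ⟨e_i, A e_i⟩` (an absolutely convergent sum for trace-class `A`). -/
def trace (A : E →L[ℂ] E) : ℂ := ∑' i, ⟪basis E i, A (basis E i)⟫_ℂ

theorem norm_abs_apply (A : E →L[ℂ] E) (v : E) : ‖CFC.abs A v‖ = ‖A v‖ := by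
  have h : CFC.abs A * CFC.abs A = star A * A := CFC.abs_mul_abs A
  have hs : star (CFC.abs A) = CFC.abs A := (IsSelfAdjoint.of_nonneg (CFC.abs_nonneg A)).star_eq
  have h1 : ⟪CFC.abs A v, CFC.abs A v⟫_ℂ = ⟪A v, A v⟫_ℂ := by
    rw [← ContinuousLinearMap.adjoint_inner_right, ← ContinuousLinearMap.adjoint_inner_right A,
      ← ContinuousLinearMap.star_eq_adjoint, ← ContinuousLinearMap.star_eq_adjoint, hs]
    exact congrArg (fun B : E →L[ℂ] E => ⟪v, B v⟫_ℂ) h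
  have h2 : ‖CFC.abs A v‖ ^ 2 = ‖A v‖ ^ 2 := by
    rw [← inner_self_eq_norm_sq (𝕜 := ℂ), ← inner_self_eq_norm_sq (𝕜 := ℂ), h1]
  exact (sq_eq_sq₀ (norm_nonneg _) (norm_nonneg _)).1 h2

/-- Polar decomposition. -/
theorem exists_polar (A : E →L[ℂ] E) :
    ∃ U : E →L[ℂ] E, (∀ v, ‖U v‖ ≤ ‖v‖) ∧ A = U * CFC.abs A ∧ CFC.abs A = star U * A := by
  classical
  set S : E →L[ℂ] E := CFC.abs A with hS
  let V : Submodule ℂ E := (LinearMap.range (S : E →ₗ[ℂ] E)).topologicalClosure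
  have : CompleteSpace V :=
    (Submodule.isClosed_topologicalClosure _).completeSpace_coe
  let e : E →ₗ[ℂ] V := (S : E →ₗ[ℂ] E).codRestrict V
    (fun v => Submodule.le_topologicalClosure _ (LinearMap.mem_range_self _ v))
  have hdense : DenseRange e := by
    intro x
    rw [Topology.IsInducing.subtypeVal.closure_eq_preimage_closure_image]
    change (x : E) ∈ closure (Subtype.val '' Set.range e)
    have himg : (Subtype.val '' Set.range e : Set E) =
        (LinearMap.range (S : E →ₗ[ℂ] E) : Set E) := by
      ext z
      constructor
      · rintro ⟨_, ⟨v, rfl⟩, rfl⟩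
        exact ⟨v, rfl⟩
      · rintro ⟨v, rfl⟩
        exact ⟨e v, ⟨v, rfl⟩, rfl⟩
    rw [himg]
    exact x.2
  have hbd : ∀ v, ‖(A : E →ₗ[ℂ] E) v‖ ≤ 1 * ‖e v‖ := by
    intro v
    rw [one_mul]
    exact (norm_abs_apply A v).ge
  let U₀ : V →L[ℂ] E := (A : E →ₗ[ℂ] E).extendOfNorm e
  let U : E →L[ℂ] E := U₀ ∘L V.orthogonalProjectionOnto
  have hU : ∀ v, ‖U v‖ ≤ ‖v‖ := by
    intro v
    have h1 : ‖U₀ (V.orthogonalProjectionOnto v)‖ ≤ 1 * ‖V.orthogonalProjectionOnto v‖ :=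
      LinearMap.norm_extendOfNorm_apply_le hdense 1 hbd _
    rw [one_mul] at h1
    exact h1.trans (V.norm_orthogonalProjectionOnto_apply_le v)
  have hUS : ∀ v, U (S v) = A v := by
    intro v
    have h1 : V.orthogonalProjectionOnto (S v) = e v :=
      Submodule.orthogonalProjectionOnto_mem_subspace_eq_self (e v)
    show U₀ (V.orthogonalProjectionOnto (S v)) = A v
    rw [h1]
    exact LinearMap.extendOfNorm_eq hdense ⟨1, hbd⟩ v
  refine ⟨U, hU, ?_, ?_⟩
  · ext v
    exact (hUS v).symm
  · ext v
    have hadj : ∀ w, ‖star U w‖ ≤ ‖w‖ := by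
      intro w
      have hn : ‖star U‖ ≤ 1 := by
        rw [norm_star]
        exact U.opNorm_le_bound zero_le_one (fun v => by simpa using hU v)
      simpa using (star U).le_of_opNorm_le hn w
    have hAv : ‖A v‖ = ‖S v‖ := (norm_abs_apply A v).symm
    have hin : RCLike.re ⟪star U (A v), S v⟫_ℂ = ‖A v‖ ^ 2 := by
      rw [ContinuousLinearMap.star_eq_adjoint, ContinuousLinearMap.adjoint_inner_left, hUS,
        inner_self_eq_norm_sq]
    have h0 : ‖star U (A v) - S v‖ ^ 2 ≤ 0 := by
      rw [@norm_sub_sq ℂ, hin]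
      have := hadj (A v)
      have h2 : ‖star U (A v)‖ ^ 2 ≤ ‖A v‖ ^ 2 := by gcongr
      rw [← hAv]
      linarith
    have h3 : ‖star U (A v) - S v‖ = 0 := by
      have := sq_nonneg ‖star U (A v) - S v‖
      exact pow_eq_zero_iff (two_ne_zero) |>.1 (le_antisymm h0 this)
    exact (sub_eq_zero.1 (norm_eq_zero.1 h3)).symm

/-- `A = ∑ |x_i⟩⟨y_i|` with `∑ ‖x_i‖ ‖y_i‖ < ∞`. -/
def HasNuclearSum {ι : Type*} {E F : Type*} [NormedAddCommGroup E] [InnerProductSpace ℂ E]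
    [NormedAddCommGroup F] [InnerProductSpace ℂ F]
    (A : F →L[ℂ] E) (x : ι → E) (y : ι → F) : Prop :=
  ∑' i, ‖x i‖ₑ * ‖y i‖ₑ < ∞ ∧ ∀ v, HasSum (fun i => ⟪y i, v⟫_ℂ • x i) (A v)

theorem exists_hasNuclearSum {A : E →L[ℂ] E} (hA : traceNorm A < ∞) :
    ∃ x y : basisIndex E → E, HasNuclearSum A x y := by
  obtain ⟨U, hU, hA1, -⟩ := exists_polar A
  have hS : 0 ≤ CFC.abs A := CFC.abs_nonneg A
  set R : E →L[ℂ] E := CFC.sqrt (CFC.abs A) with hR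
  have hRR : R * R = CFC.abs A := CFC.sqrt_mul_sqrt_self _ hS
  have hRs : star R = R := (IsSelfAdjoint.of_nonneg (CFC.sqrt_nonneg _)).star_eq
  have hRin : ∀ v w, ⟪R v, w⟫_ℂ = ⟪v, R w⟫_ℂ := by
    intro v w
    rw [← ContinuousLinearMap.adjoint_inner_right, ← ContinuousLinearMap.star_eq_adjoint, hRs]
  refine ⟨fun i => U (R (basis E i)), fun i => R (basis E i), ?_, ?_⟩
  · refine lt_of_le_of_lt (ENNReal.tsum_le_tsum fun i => ?_) hA
    have h1 : RCLike.re ⟪basis E i, CFC.abs A (basis E i)⟫_ℂ = ‖R (basis E i)‖ ^ 2 := by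
      rw [← hRR]
      change RCLike.re ⟪basis E i, R (R (basis E i))⟫_ℂ = _
      rw [← hRin, inner_self_eq_norm_sq]
    rw [h1, ← ofReal_norm, ← ofReal_norm,
      ← ENNReal.ofReal_mul (norm_nonneg _)]
    apply ENNReal.ofReal_le_ofReal
    rw [sq]
    gcongr
    exact hU _
  · intro v
    have h1 := ((basis E).hasSum_repr (R v)).mapL (U * R)
    have h2 : A v = (U * R) (R v) := by
      conv_lhs => rw [hA1, ← hRR]
      rfl
    rw [h2]
    convert h1 using 2 with i
    rw [map_smul, HilbertBasis.repr_apply_apply, hRin]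
    rfl

/-- Bessel and Cauchy-Schwarz. -/
theorem tsum_enorm_inner_mul_le (x y : E) :
    ∑' i, ‖⟪x, basis E i⟫_ℂ‖ₑ * ‖⟪basis E i, y⟫_ℂ‖ₑ ≤ ‖x‖ₑ * ‖y‖ₑ := by
  rw [ENNReal.tsum_eq_iSup_sum]
  refine iSup_le fun s => ?_
  simp only [← ofReal_norm, ← ENNReal.ofReal_mul (norm_nonneg _)]
  rw [← ENNReal.ofReal_sum_of_nonneg (fun i _ => by positivity)]
  apply ENNReal.ofReal_le_ofReal
  have hx := (basis E).orthonormal.sum_inner_products_le (s := s) x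
  have hy := (basis E).orthonormal.sum_inner_products_le (s := s) y
  have hcs := Finset.sum_mul_sq_le_sq_mul_sq s (fun i => ‖⟪x, basis E i⟫_ℂ‖)
    (fun i => ‖⟪basis E i, y⟫_ℂ‖)
  simp only [norm_inner_symm x] at hcs ⊢
  refine abs_le_of_sq_le_sq' ?_ (by positivity) |>.2
  calc _ ≤ _ := hcs
    _ ≤ ‖x‖ ^ 2 * ‖y‖ ^ 2 := by gcongr
    _ = _ := by ring

theorem traceNorm_lt_top {ι : Type*} {A : E →L[ℂ] E} {x y : ι → E} (h : HasNuclearSum A x y) :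
    traceNorm A < ∞ := by
  obtain ⟨U, hU, -, hA⟩ := exists_polar A
  have hadj : ∀ w, ‖star U w‖ₑ ≤ ‖w‖ₑ := by
    intro w
    have hn : ‖star U‖ ≤ 1 := by
      rw [norm_star]
      exact U.opNorm_le_bound zero_le_one (fun v => by simpa using hU v)
    simpa [enorm_le_iff_norm_le] using (star U).le_of_opNorm_le hn w
  refine lt_of_le_of_lt ?_ h.1
  calc traceNorm A
      ≤ ∑' j, ∑' i, ‖⟪y i, basis E j⟫_ℂ‖ₑ * ‖⟪basis E j, star U (x i)⟫_ℂ‖ₑ := by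
        refine ENNReal.tsum_le_tsum fun j => ?_
        have h1 : HasSum (fun i => ⟪y i, basis E j⟫_ℂ * ⟪basis E j, star U (x i)⟫_ℂ)
            ⟪basis E j, CFC.abs A (basis E j)⟫_ℂ := by
          have h2 := (h.2 (basis E j)).mapL (innerSL ℂ (basis E j) ∘L star U)
          rw [hA]
          simpa using h2
        calc ENNReal.ofReal (RCLike.re ⟪basis E j, CFC.abs A (basis E j)⟫_ℂ)
            ≤ ‖⟪basis E j, CFC.abs A (basis E j)⟫_ℂ‖ₑ := by
              rw [← ofReal_norm]
              exact ENNReal.ofReal_le_ofReal (RCLike.re_le_norm _)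
          _ ≤ ∑' i, ‖⟪y i, basis E j⟫_ℂ * ⟪basis E j, star U (x i)⟫_ℂ‖ₑ := by
              rw [← h1.tsum_eq]
              exact enorm_tsum_le_tsum_enorm
          _ = _ := by simp only [enorm_mul]
    _ = ∑' i, ∑' j, ‖⟪y i, basis E j⟫_ℂ‖ₑ * ‖⟪basis E j, star U (x i)⟫_ℂ‖ₑ :=
        ENNReal.tsum_comm
    _ ≤ ∑' i, ‖x i‖ₑ * ‖y i‖ₑ := by
        refine ENNReal.tsum_le_tsum fun i => (tsum_enorm_inner_mul_le _ _).trans ?_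
        rw [mul_comm]
        gcongr
        exact hadj _

variable (E) in
/-- The space `τc(E)` of trace-class operators: the bounded `A` with `‖A‖₁ = tr |A| < ∞`. -/
def traceClass : Submodule ℂ (E →L[ℂ] E) where
  carrier := {A | traceNorm A < ∞}
  zero_mem' := by
    refine traceNorm_lt_top (ι := PEmpty.{1}) (x := PEmpty.elim) (y := PEmpty.elim) ⟨by simp, ?_⟩
    intro v
    simp
  add_mem' := by
    intro A B hA hB
    obtain ⟨x, y, h⟩ := exists_hasNuclearSum hA
    obtain ⟨x', y', h'⟩ := exists_hasNuclearSum hB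
    refine traceNorm_lt_top (x := Sum.elim x x') (y := Sum.elim y y') ⟨?_, fun v => ?_⟩
    · rw [ENNReal.summable.tsum_sum ENNReal.summable]
      simpa using ⟨h.1, h'.1⟩
    · exact (h.2 v).sum (h'.2 v)
  smul_mem' := by
    intro c A hA
    obtain ⟨x, y, h⟩ := exists_hasNuclearSum hA
    refine traceNorm_lt_top (x := fun i => c • x i) (y := y) ⟨?_, fun v => ?_⟩
    · simp only [enorm_smul, mul_assoc, ENNReal.tsum_mul_left]
      exact ENNReal.mul_lt_top (by simp) h.1
    · simpa [smul_comm c] using (h.2 v).const_smul c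

theorem comp_comp_mem_traceClass {F : Type v} [NormedAddCommGroup F] [InnerProductSpace ℂ F]
    [CompleteSpace F] (L : E →L[ℂ] F) (A : traceClass E) (W : F →L[ℂ] E) :
    L ∘L (A : E →L[ℂ] E) ∘L W ∈ traceClass F := by
  obtain ⟨x, y, h⟩ := exists_hasNuclearSum A.2
  refine traceNorm_lt_top (x := fun i => L (x i))
    (y := fun i => ContinuousLinearMap.adjoint W (y i)) ⟨?_, fun v => ?_⟩
  · calc _ ≤ ∑' i, ‖L‖ₑ * ‖ContinuousLinearMap.adjoint W‖ₑ * (‖x i‖ₑ * ‖y i‖ₑ) := by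
          refine ENNReal.tsum_le_tsum fun i => ?_
          rw [mul_mul_mul_comm]
          gcongr
          · exact L.le_opENorm _
          · exact (ContinuousLinearMap.adjoint W).le_opENorm _
      _ < ∞ := by
          rw [ENNReal.tsum_mul_left]
          exact ENNReal.mul_lt_top (ENNReal.mul_lt_top (by simp) (by simp)) h.1
  · simpa [ContinuousLinearMap.adjoint_inner_left] using (h.2 (W v)).mapL L

end TraceClass

/-! ### Composite systems and completely positive maps -/

/-- The composite system `H ⊗ K`, where `K = ℓ²(κ)` and `H ⊗ ℓ²(κ)` is `⨁_κ H = ℓ²(κ; H)`, the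
vector `φ ⊗ e_k` being `φ` placed at the coordinate `k`. -/
abbrev WithAncilla (H : Type u) [NormedAddCommGroup H] (κ : Type) : Type u :=
  lp (fun _ : κ => H) 2

variable {H : Type u} [NormedAddCommGroup H] [InnerProductSpace ℂ H] [CompleteSpace H]
variable {H' : Type v} [NormedAddCommGroup H'] [InnerProductSpace ℂ H'] [CompleteSpace H']

open Classical in
/-- The `(k, l)` block `a : H → H` of an operator `A` on `H ⊗ K`, that is,
`⟨φ, a ψ⟩ = ⟨φ ⊗ e_k, A (ψ ⊗ e_l)⟩`, so that `A = ∑ A_kl ⊗ |e_k⟩⟨e_l|`. -/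
def block {κ : Type} (A : traceClass (WithAncilla H κ)) (k l : κ) : traceClass H :=
  ⟨lp.evalCLM ℂ (fun _ : κ => H) 2 k ∘L (A : WithAncilla H κ →L[ℂ] WithAncilla H κ) ∘L
    lp.singleContinuousLinearMap ℂ (fun _ : κ => H) 2 l, comp_comp_mem_traceClass _ A _⟩

variable (H H') in
/-- Linear maps from trace-class operators on `H` to trace-class operators on `H'`. -/
abbrev Superoperator : Type (max u v) := traceClass H →ₗ[ℂ] traceClass H'

/-- `B = (Λ ⊗ I)(A)`: the blocks of `B` are the images under `Λ` of the blocks of `A`. -/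
def IsAmpliation (Λ : Superoperator H H') {κ : Type} (A : traceClass (WithAncilla H κ))
    (B : traceClass (WithAncilla H' κ)) : Prop :=
  ∀ k l, block B k l = Λ (block A k l)

open Classical in
/-- `(Λ ⊗ I)(A)`. It exists and is unique if `Λ` is completely positive or completely bounded. -/
def ampliation (Λ : Superoperator H H') {κ : Type} (A : traceClass (WithAncilla H κ)) :
    traceClass (WithAncilla H' κ) :=
  if h : ∃ B, IsAmpliation Λ A B then h.choose else 0

/-- `Λ` is completely positive: `A ≥ 0` implies `(Λ ⊗ I)(A) ≥ 0`, for every ancilla `K`. -/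
def IsCompletelyPositive (Λ : Superoperator H H') : Prop :=
  ∀ (κ : Type) [Countable κ] (A : traceClass (WithAncilla H κ))
    (B : traceClass (WithAncilla H' κ)), IsAmpliation Λ A B →
      (A : WithAncilla H κ →L[ℂ] WithAncilla H κ).IsPositive →
      (B : WithAncilla H' κ →L[ℂ] WithAncilla H' κ).IsPositive

/-- Completely positive and trace-preserving maps, i.e. quantum operations. -/
def IsCPTP (Λ : Superoperator H H') : Prop :=
  IsCompletelyPositive Λ ∧
    ∀ A : traceClass H, trace (Λ A : H' →L[ℂ] H') = trace (A : H →L[ℂ] H)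

/-- `‖Λ‖_cb = sup {‖(Λ ⊗ I)(X)‖₁ : ‖X‖₁ = 1}` over all ancillas, with values in `[0, ∞]`; the
infimum over the at most one `B = (Λ ⊗ I)(X)` is `∞` when `(Λ ⊗ I)(X)` does not exist. -/
def cbNorm (Λ : Superoperator H H') : ℝ≥0∞ :=
  ⨆ (κ : Type) (_ : Countable κ) (X : traceClass (WithAncilla H κ))
    (_ : traceNorm (X : WithAncilla H κ →L[ℂ] WithAncilla H κ) = 1),
    ⨅ (B : traceClass (WithAncilla H' κ)) (_ : IsAmpliation Λ X B),
      traceNorm (B : WithAncilla H' κ →L[ℂ] WithAncilla H' κ)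

/-- Density operators. -/
def IsDensity {E : Type u} [NormedAddCommGroup E] [InnerProductSpace ℂ E] [CompleteSpace E]
    (ρ : traceClass E) : Prop :=
  (ρ : E →L[ℂ] E).IsPositive ∧ trace (ρ : E →L[ℂ] E) = 1

/-! ### Measurements -/

/-- A positive operator valued measure on `Ω`, `σ`-additive in the weak operator topology. -/
structure POVM (Ω : Type*) [MeasurableSpace Ω] (E : Type*) [NormedAddCommGroup E]
    [InnerProductSpace ℂ E] where
  /-- The operator `M(Δ)`. -/
  op : Set Ω → E →L[ℂ] E
  isPositive : ∀ Δ, MeasurableSet Δ → (op Δ).IsPositive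
  op_univ : op Set.univ = 1
  hasSum_iUnion : ∀ Δ : ℕ → Set Ω, (∀ k, MeasurableSet (Δ k)) → Pairwise (Function.onFun Disjoint Δ) →
    ∀ x y, HasSum (fun k => ⟪x, op (Δ k) y⟫_ℂ) ⟪x, op (⋃ k, Δ k) y⟫_ℂ

open Classical in
/-- The measure `Δ ↦ tr (ρ M(Δ))`, which exists for every positive trace-class `ρ` (for a density
operator it is the distribution of the outcome of the measurement `M` in the state `ρ`). -/
def outcomeMeasure {Ω : Type*} [MeasurableSpace Ω] {E : Type*} [NormedAddCommGroup E]
    [InnerProductSpace ℂ E] [CompleteSpace E] (ρ : traceClass E) (M : POVM Ω E) : Measure Ω :=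
  if h : ∃ μ : Measure Ω, ∀ Δ, MeasurableSet Δ →
      μ Δ = ENNReal.ofReal (trace ((ρ : E →L[ℂ] E) ∘L M.op Δ)).re
  then h.choose else 0

/-! ### Estimation of quantum operations -/

/-- The parameter space `ℝ^m` with its Euclidean norm. -/
abbrev Param (m : ℕ) : Type := EuclideanSpace ℝ (Fin m)

variable (H H') in
/-- An estimator: an ancilla `K = ℓ²(κ)`, an input state `ρ` on `H ⊗ K`, quantum operations `Ξ`
from `H' ⊗ K` to `H ⊗ K` applied between consecutive uses of the unknown operation (in a scheme
with `n` uses only `Ξ 0, …, Ξ (n - 2)` matter), a measurement `M` on `H' ⊗ K` with outcomes in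
`ℝ^l`, and a measurable function `T` of the outcome. -/
structure Estimator (m : ℕ) where
  κ : Type
  countable : Countable κ
  ρ : traceClass (WithAncilla H κ)
  isDensity : IsDensity ρ
  Ξ : ℕ → Superoperator (WithAncilla H' κ) (WithAncilla H κ)
  isCPTP : ∀ k, IsCPTP (Ξ k)
  l : ℕ
  M : POVM (EuclideanSpace ℝ (Fin l)) (WithAncilla H' κ)
  T : EuclideanSpace ℝ (Fin l) → Param m
  measurable : Measurable T

namespace Estimator

variable {m : ℕ}

/-- `(Φ_k ⊗ I) ∘ Ξ_{k-1} ∘ (Φ_{k-1} ⊗ I) ∘ ⋯ ∘ Ξ_0 ∘ (Φ_0 ⊗ I) (ρ)`. -/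
def iterate (e : Estimator H H' m) (Φ : ℕ → Superoperator H H') :
    ℕ → traceClass (WithAncilla H' e.κ)
  | 0 => ampliation (Φ 0) e.ρ
  | k + 1 => ampliation (Φ (k + 1)) (e.Ξ k (iterate e Φ k))

/-- The final state when `Φ_0, …, Φ_{n-1}` are used in this order (`n ≥ 1`). -/
def output (e : Estimator H H' m) (Φ : ℕ → Superoperator H H') (n : ℕ) :
    traceClass (WithAncilla H' e.κ) :=
  e.iterate Φ (n - 1)

/-- The distribution of the data after `n ≥ 1` uses of the operation `Λ`. -/
def law (e : Estimator H H' m) (Λ : Superoperator H H') (n : ℕ) :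
    Measure (EuclideanSpace ℝ (Fin e.l)) :=
  outcomeMeasure (e.output (fun _ => Λ) n) e.M

/-- The expectation of the estimate after `n ≥ 1` uses of `Λ`. -/
def expectation (e : Estimator H H' m) (Λ : Superoperator H H') (n : ℕ) : Param m :=
  ∫ ω, e.T ω ∂(e.law Λ n)

/-- The mean square error matrix `E (T^i - θ^i) (T^j - θ^j)` after `n ≥ 1` uses of `Λ`. -/
def mse (e : Estimator H H' m) (Λ : Superoperator H H') (θ : Param m) (n : ℕ) :
    Matrix (Fin m) (Fin m) ℝ :=
  fun i j => ∫ ω, (e.T ω i - θ i) * (e.T ω j - θ j) ∂(e.law Λ n)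

/-- The sum over `κ < n` of the final states in which the `κ`-th use of `Λ` is replaced
by `S`. -/
def outputReplacing (e : Estimator H H' m) (Λ S : Superoperator H H') (n : ℕ) :
    traceClass (WithAncilla H' e.κ) :=
  ∑ k ∈ Finset.range n, e.output (Function.update (fun _ => Λ) k S) n

end Estimator

section Model

variable {m : ℕ}

/-- `D` is the partial derivative at `θ` in the `i`-th coordinate of the family `Λ`, the limit being
taken in the norm `‖·‖_cb`. -/
def HasPartialDerivAt (Λ : Param m → Superoperator H H') (i : Fin m) (D : Superoperator H H')
    (θ : Param m) : Prop :=
  Tendsto (fun t : ℝ => cbNorm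
    (((t⁻¹ : ℝ) : ℂ) • (Λ (θ + t • EuclideanSpace.single i (1 : ℝ)) - Λ θ) - D)) (𝓝[≠] 0) (𝓝 0)

/-- Local uniform continuity on `Θ` in the norm `‖·‖_cb`. -/
def LocallyUniformlyContinuousOn (F : Param m → Superoperator H H') (Θ : Set (Param m)) : Prop :=
  ∀ θ₀ ∈ Θ, ∃ r > 0, ∀ ε : ℝ≥0∞, 0 < ε → ∃ δ > 0,
    ∀ θ ∈ Θ ∩ Metric.ball θ₀ r, ∀ θ' ∈ Θ ∩ Metric.ball θ₀ r,
      dist θ θ' < δ → cbNorm (F θ - F θ') < ε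

/-- The regularity condition on the model: `dΛ i = ∂_i Λ` and `ddΛ i j = ∂_i ∂_j Λ` exist on `Θ`,
are locally uniformly continuous, and are bounded by `a₁ / 2`. -/
structure RegularModel (Θ : Set (Param m)) (Λ : Param m → Superoperator H H')
    (dΛ : Fin m → Param m → Superoperator H H')
    (ddΛ : Fin m → Fin m → Param m → Superoperator H H') (a₁ : ℝ≥0) : Prop where
  hasDeriv : ∀ i, ∀ θ ∈ Θ, HasPartialDerivAt Λ i (dΛ i θ) θ
  hasDeriv₂ : ∀ i j, ∀ θ ∈ Θ, HasPartialDerivAt (dΛ j) i (ddΛ i j θ) θ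
  continuous : ∀ i, LocallyUniformlyContinuousOn (dΛ i) Θ
  continuous₂ : ∀ i j, LocallyUniformlyContinuousOn (ddΛ i j) Θ
  bound : ∀ i, ∀ θ ∈ Θ, cbNorm (dΛ i θ) ≤ ((a₁ / 2 : ℝ≥0) : ℝ≥0∞)
  bound₂ : ∀ i j, ∀ θ ∈ Θ, cbNorm (ddΛ i j θ) ≤ ((a₁ / 2 : ℝ≥0) : ℝ≥0∞)

/-- The maps `S i θ` are positive majorants of the derivatives near `θ`: for some `a₂ > 0`,
`(S i θ ⊗ I)(ρ) ≥ (∂_i Λ_{θ₀} ⊗ I)(ρ)` for all `ρ ≥ 0` whenever `‖θ₀ - θ‖ < a₂`. -/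
def IsMajorant (Θ : Set (Param m)) (dΛ : Fin m → Param m → Superoperator H H')
    (S : Fin m → Param m → Superoperator H H') : Prop :=
  ∃ a₂ > 0, ∀ i, ∀ θ ∈ Θ, IsCompletelyPositive (S i θ) ∧
    ∀ θ₀ ∈ Θ, ‖θ₀ - θ‖ < a₂ → IsCompletelyPositive (S i θ - dΛ i θ₀)

/-- The regularity condition on a sequence of estimators, the `n`-th of which uses the unknown
operation `n` times. -/
def RegularEstimators (Θ : Set (Param m)) (Λ : Param m → Superoperator H H')
    (dΛ : Fin m → Param m → Superoperator H H') (a₁ : ℝ≥0) (e : ℕ → Estimator H H' m) : Prop :=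
  ∃ S : Fin m → Param m → Superoperator H H', IsMajorant Θ dΛ S ∧
    ∀ n ≥ 1, ∃ a₄ : ℝ≥0, ∀ θ ∈ Θ,
      (∀ i, ∫⁻ ω, ‖(e n).T ω - θ‖ₑ
          ∂(outcomeMeasure ((e n).outputReplacing (Λ θ) (S i θ) n) (e n).M) ≤ n * a₁ * a₄) ∧
      ∫⁻ ω, ‖(e n).T ω - θ‖ₑ ^ 2 ∂((e n).law (Λ θ) n) ≤ n * (a₄ : ℝ≥0∞) ^ 2

/-- Asymptotic unbiasedness: for every `θ ∈ Θ`, `E_θ[T_n] → θ`, and the partial derivatives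
`∂_j E_θ[T_n^i]` exist and tend to `δ_ij`. -/
def AsymptoticallyUnbiased (Θ : Set (Param m)) (Λ : Param m → Superoperator H H')
    (e : ℕ → Estimator H H' m) : Prop :=
  ∀ θ ∈ Θ, Tendsto (fun n => (e n).expectation (Λ θ) n) atTop (𝓝 θ) ∧
    ∃ B : ℕ → Matrix (Fin m) (Fin m) ℝ,
      (∀ n ≥ 1, ∀ i j, HasLineDerivAt ℝ (fun θ' => (e n).expectation (Λ θ') n i) (B n i j) θ
        (EuclideanSpace.single j (1 : ℝ))) ∧
      Tendsto B atTop (𝓝 1)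

/-- The admissible sequences of estimators. -/
def Admissible (Θ : Set (Param m)) (Λ : Param m → Superoperator H H')
    (dΛ : Fin m → Param m → Superoperator H H') (a₁ : ℝ≥0) (e : ℕ → Estimator H H' m) : Prop :=
  AsymptoticallyUnbiased Θ Λ e ∧ RegularEstimators Θ Λ dΛ a₁ e

/-- The first-order asymptotic cost: the infimum of `limsup n Tr G MSE_θ[e_n]` over the admissible
sequences of estimators. -/
def asymptoticCost (Θ : Set (Param m)) (Λ : Param m → Superoperator H H')
    (dΛ : Fin m → Param m → Superoperator H H') (a₁ : ℝ≥0) (G : Matrix (Fin m) (Fin m) ℝ)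
    (θ : Param m) : ℝ≥0∞ :=
  ⨅ (e : ℕ → Estimator H H' m) (_ : Admissible Θ Λ dΛ a₁ e),
    limsup (fun n : ℕ => ENNReal.ofReal (n * (G * (e n).mse (Λ θ) θ n).trace)) atTop

end Model

end QuantumEstimation

end

/-!
If `Λ_θ ± δ ∂Λ_θ` is completely positive along a line, then every functional
`Ψ ↦ ∑ ⟨x_k, Ψ(A_kl) x_l⟩` with `A ≥ 0` satisfies a Grönwall inequality on that line, and
`Λ_θ ± r⁻¹ (Λ_{θ+t} - Λ_θ)` are quantum operations for `r = exp (t / δ) - 1`. Hence `Λ_θ` and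
`Λ_{θ+t}` are mixtures of the same two operations, with weights `(1/2, 1/2)` and
`((1 + r)/2, (1 - r)/2)`: each use of the unknown operation conveys at most one toss of a slightly
biased coin, whatever happens between the uses. The `χ²`-divergence of `n` such tosses is
`(1 + r²)^n - 1`, so the Chapman–Robbins inequality, divided by `t²` with `t → 0`, gives the
Cramér–Rao bound `(∂ E⟨w, T⟩)² ≤ (n / δ²) E⟨w, T - θ⟩²`, and `n` times the mean square error stays
bounded away from zero.
-/

namespace QuantumEstimation

open scoped ComplexOrder

section Positive

variable {E : Type*} [NormedAddCommGroup E] [InnerProductSpace ℂ E]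

theorem isPositive_iff_inner_nonneg {A : E →L[ℂ] E} : A.IsPositive ↔ ∀ x, 0 ≤ ⟪x, A x⟫_ℂ := by
  refine ⟨fun h => h.inner_nonneg_right, fun h => ?_⟩
  rw [ContinuousLinearMap.isPositive_iff_complex]
  intro x
  obtain ⟨hre, him⟩ := Complex.nonneg_iff.1 (h x)
  have hswap : ⟪A x, x⟫_ℂ = ⟪x, A x⟫_ℂ := by
    rw [← inner_conj_symm, Complex.conj_eq_iff_im]
    exact him.symm
  rw [hswap]
  exact ⟨Complex.ext rfl him, hre⟩

theorem isPositive_sum_smul {ι : Type*} (s : Finset ι) {c : ι → ℝ} {A : ι → E →L[ℂ] E}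
    (hc : ∀ i ∈ s, 0 ≤ c i) (hA : ∀ i ∈ s, (A i).IsPositive) :
    (∑ i ∈ s, (c i : ℂ) • A i).IsPositive :=
  ContinuousLinearMap.isPositive_sum _ fun i hi =>
    (hA i hi).smul_of_nonneg (Complex.zero_le_real.2 (hc i hi))

theorem exists_isSymmetric_mul_self_eq [CompleteSpace E] {A : E →L[ℂ] E} (hA : A.IsPositive) :
    ∃ R : E →L[ℂ] E, (R : E →ₗ[ℂ] E).IsSymmetric ∧ R * R = A :=
  ⟨CFC.sqrt A,
    ContinuousLinearMap.isSelfAdjoint_iff_isSymmetric.1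
      (IsSelfAdjoint.of_nonneg (CFC.sqrt_nonneg A)),
    CFC.sqrt_mul_sqrt_self _ ((ContinuousLinearMap.nonneg_iff_isPositive A).2 hA)⟩

theorem ofReal_re_inner_mul_self {R : E →L[ℂ] E} (hR : (R : E →ₗ[ℂ] E).IsSymmetric) (v : E) :
    ENNReal.ofReal (RCLike.re ⟪v, (R * R) v⟫_ℂ) = ‖R v‖ₑ ^ 2 := by
  have h : ⟪v, (R * R) v⟫_ℂ = ⟪R v, R v⟫_ℂ := (hR v (R v)).symm
  rw [h, inner_self_eq_norm_sq, ENNReal.ofReal_pow (norm_nonneg _), ofReal_norm]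

end Positive

section Parseval

theorem enorm_inner_le {E : Type*} [NormedAddCommGroup E] [InnerProductSpace ℂ E] (x y : E) :
    ‖⟪x, y⟫_ℂ‖ₑ ≤ ‖x‖ₑ * ‖y‖ₑ := by
  simp only [enorm, ← ENNReal.coe_mul, ENNReal.coe_le_coe]
  exact nnnorm_inner_le_nnnorm x y

theorem enorm_sq_eq_tsum {ι : Type*} {G : ι → Type*} [∀ i, NormedAddCommGroup (G i)]
    (v : lp G 2) : ‖v‖ₑ ^ 2 = ∑' i, ‖v i‖ₑ ^ 2 := by
  have h : HasSum (fun i => ‖v i‖ ^ 2) (‖v‖ ^ 2) := by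
    simpa using lp.hasSum_norm (p := 2) (by simp) v
  simp only [← ofReal_norm, ← ENNReal.ofReal_pow (norm_nonneg _), ← h.tsum_eq]
  exact ENNReal.ofReal_tsum_of_nonneg (fun i => by positivity) h.summable

/-- Parseval frames: `∑ |⟨f_i, v⟩|² = ‖v‖²` for all `v`. The trace of a positive operator can be
computed in any of them, in particular in the product vectors of a composite system. -/
def IsParseval {ι E : Type*} [NormedAddCommGroup E] [InnerProductSpace ℂ E] (f : ι → E) : Prop :=
  ∀ v, ∑' i, ‖⟪f i, v⟫_ℂ‖ₑ ^ 2 = ‖v‖ₑ ^ 2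

theorem isParseval_hilbertBasis {ι E : Type*} [NormedAddCommGroup E] [InnerProductSpace ℂ E]
    (b : HilbertBasis ι ℂ E) : IsParseval b := fun v => by
  have hrepr : ‖b.repr v‖ₑ = ‖v‖ₑ := b.repr.toLinearIsometry.enorm_map v
  simp only [← b.repr_apply_apply, ← enorm_sq_eq_tsum, hrepr]

end Parseval

section Trace

variable {E : Type*} [NormedAddCommGroup E] [InnerProductSpace ℂ E] [CompleteSpace E]

theorem traceNorm_of_isPositive {A : E →L[ℂ] E} (hA : A.IsPositive) : traceNorm A = posTrace A := by
  rw [traceNorm, CFC.abs_of_nonneg A ((ContinuousLinearMap.nonneg_iff_isPositive A).2 hA)]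

theorem posTrace_eq_tsum {ι : Type*} {f : ι → E} (hf : IsParseval f) {A : E →L[ℂ] E}
    (hA : A.IsPositive) : posTrace A = ∑' i, ENNReal.ofReal (RCLike.re ⟪f i, A (f i)⟫_ℂ) := by
  obtain ⟨R, hR, rfl⟩ := exists_isSymmetric_mul_self_eq hA
  have hswap (i j) : ‖⟪f i, R (basis E j)⟫_ℂ‖ₑ = ‖⟪basis E j, R (f i)⟫_ℂ‖ₑ := by
    rw [← inner_conj_symm, RCLike.enorm_conj]
    exact congrArg _ (hR _ _)
  simp only [posTrace, ofReal_re_inner_mul_self hR]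
  calc ∑' j, ‖R (basis E j)‖ₑ ^ 2 = ∑' j, ∑' i, ‖⟪f i, R (basis E j)⟫_ℂ‖ₑ ^ 2 := by simp only [hf _]
    _ = ∑' i, ∑' j, ‖⟪f i, R (basis E j)⟫_ℂ‖ₑ ^ 2 := ENNReal.tsum_comm
    _ = ∑' i, ‖R (f i)‖ₑ ^ 2 := by simp only [hswap, isParseval_hilbertBasis (basis E) _]

theorem enorm_sq_apply_le_posTrace_mul_self {R : E →L[ℂ] E} (hR : (R : E →ₗ[ℂ] E).IsSymmetric)
    (v : E) : ‖R v‖ₑ ^ 2 ≤ posTrace (R * R) * ‖v‖ₑ ^ 2 := by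
  rw [← isParseval_hilbertBasis (basis E), posTrace, ← ENNReal.tsum_mul_right]
  refine ENNReal.tsum_le_tsum fun i => ?_
  rw [ofReal_re_inner_mul_self hR, ← mul_pow]
  gcongr
  calc ‖⟪basis E i, R v⟫_ℂ‖ₑ = ‖⟪R (basis E i), v⟫_ℂ‖ₑ := congrArg _ (hR _ _).symm
    _ ≤ ‖R (basis E i)‖ₑ * ‖v‖ₑ := enorm_inner_le _ _

theorem enorm_apply_le_posTrace {A : E →L[ℂ] E} (hA : A.IsPositive) (v : E) :
    ‖A v‖ₑ ≤ posTrace A * ‖v‖ₑ := by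
  obtain ⟨R, hR, rfl⟩ := exists_isSymmetric_mul_self_eq hA
  have hbound := enorm_sq_apply_le_posTrace_mul_self hR
  rw [← ENNReal.pow_le_pow_left_iff two_ne_zero]
  calc ‖R (R v)‖ₑ ^ 2 ≤ posTrace (R * R) * (posTrace (R * R) * ‖v‖ₑ ^ 2) :=
        (hbound _).trans (mul_le_mul_right (hbound v) _)
    _ = (posTrace (R * R) * ‖v‖ₑ) ^ 2 := by ring

theorem enorm_apply_le_traceNorm (A : E →L[ℂ] E) (v : E) : ‖A v‖ₑ ≤ traceNorm A * ‖v‖ₑ := by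
  have h := enorm_apply_le_posTrace
    ((ContinuousLinearMap.nonneg_iff_isPositive _).1 (CFC.abs_nonneg A)) v
  rwa [← ofReal_norm, norm_abs_apply, ofReal_norm] at h

theorem exists_hasNuclearSum_self {A : E →L[ℂ] E} (hA : A.IsPositive) (h : posTrace A < ∞) :
    ∃ x : basisIndex E → E, HasNuclearSum A x x := by
  obtain ⟨R, hR, rfl⟩ := exists_isSymmetric_mul_self_eq hA
  refine ⟨fun i => R (basis E i), ?_, fun v => ?_⟩
  · simpa only [posTrace, ofReal_re_inner_mul_self hR, sq] using h
  · have hRv := ((basis E).hasSum_repr (R v)).mapL R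
    simp only [map_smul, HilbertBasis.repr_apply_apply] at hRv
    exact (funext fun i => congrArg (· • R (basis E i)) (hR (basis E i) v)) ▸ hRv

theorem HasNuclearSum.summable_inner_basis {ι : Type*} {A : E →L[ℂ] E} {x y : ι → E}
    (h : HasNuclearSum A x y) :
    Summable fun p : ι × basisIndex E => ⟪y p.1, basis E p.2⟫_ℂ * ⟪basis E p.2, x p.1⟫_ℂ := by
  refine Summable.of_enorm (ne_of_lt ?_)
  simp only [ENNReal.tsum_prod', enorm_mul]
  refine lt_of_le_of_lt (ENNReal.tsum_le_tsum fun i => ?_) h.1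
  rw [mul_comm ‖x i‖ₑ]
  exact tsum_enorm_inner_mul_le _ _

theorem HasNuclearSum.hasSum_inner_basis {ι : Type*} {A : E →L[ℂ] E} {x y : ι → E}
    (h : HasNuclearSum A x y) :
    HasSum (fun j => ⟪basis E j, A (basis E j)⟫_ℂ)
      (∑' p : ι × basisIndex E, ⟪y p.1, basis E p.2⟫_ℂ * ⟪basis E p.2, x p.1⟫_ℂ) := by
  refine ((Equiv.prodComm (basisIndex E) ι).hasSum_iff.2
    h.summable_inner_basis.hasSum).prod_fiberwise fun j => ?_
  have hsum := (h.2 (basis E j)).mapL (innerSL ℂ (basis E j))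
  simp only [innerSL_apply_apply, inner_smul_right] at hsum
  exact hsum

theorem HasNuclearSum.hasSum_trace {ι : Type*} {A : E →L[ℂ] E} {x y : ι → E}
    (h : HasNuclearSum A x y) : HasSum (fun i => ⟪y i, x i⟫_ℂ) (trace A) := by
  rw [trace, h.hasSum_inner_basis.tsum_eq]
  exact h.summable_inner_basis.hasSum.prod_fiberwise fun i =>
    (basis E).hasSum_inner_mul_inner (y i) (x i)

theorem hasSum_trace (A : traceClass E) :
    HasSum (fun j => ⟪basis E j, (A : E →L[ℂ] E) (basis E j)⟫_ℂ) (trace (A : E →L[ℂ] E)) := by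
  obtain ⟨x, y, h⟩ := exists_hasNuclearSum A.2
  exact h.hasSum_inner_basis.summable.hasSum

theorem posTrace_lt_top {A : traceClass E} (hA : (A : E →L[ℂ] E).IsPositive) :
    posTrace (A : E →L[ℂ] E) < ∞ :=
  traceNorm_of_isPositive hA ▸ A.2

theorem mem_traceClass_of_isPositive {A : E →L[ℂ] E} (hA : A.IsPositive) (h : posTrace A < ∞) :
    A ∈ traceClass E :=
  (traceNorm_of_isPositive hA).trans_lt h

theorem trace_eq_posTrace {A : traceClass E} (hA : (A : E →L[ℂ] E).IsPositive) :
    trace (A : E →L[ℂ] E) = ((posTrace (A : E →L[ℂ] E)).toReal : ℂ) := by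
  have hsum := hasSum_trace A
  have hre := hsum.mapL Complex.reCLM
  have hnonneg (i) := Complex.nonneg_iff.1 (hA.inner_nonneg_right (basis E i))
  obtain ⟨htr, him⟩ := Complex.nonneg_iff.1 (hsum.nonneg fun i => hA.inner_nonneg_right _)
  have hpos : posTrace (A : E →L[ℂ] E) = ENNReal.ofReal (trace (A : E →L[ℂ] E)).re :=
    (ENNReal.ofReal_tsum_of_nonneg (fun i => (hnonneg i).1) hre.summable).symm.trans
      (congrArg _ hre.tsum_eq)
  rw [hpos, ENNReal.toReal_ofReal htr]
  exact Complex.ext rfl him.symm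

theorem trace_eq_trace_iff {F : Type*} [NormedAddCommGroup F] [InnerProductSpace ℂ F]
    [CompleteSpace F] {A : traceClass E} (hA : (A : E →L[ℂ] E).IsPositive)
    {B : traceClass F} (hB : (B : F →L[ℂ] F).IsPositive) :
    trace (A : E →L[ℂ] E) = trace (B : F →L[ℂ] F) ↔
      posTrace (A : E →L[ℂ] E) = posTrace (B : F →L[ℂ] F) := by
  rw [trace_eq_posTrace hA, trace_eq_posTrace hB, Complex.ofReal_inj,
    ENNReal.toReal_eq_toReal_iff' (posTrace_lt_top hA).ne (posTrace_lt_top hB).ne]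

theorem comp_mem_traceClass (A : traceClass E) (M : E →L[ℂ] E) :
    (A : E →L[ℂ] E) ∘L M ∈ traceClass E :=
  comp_comp_mem_traceClass (ContinuousLinearMap.id ℂ E) A M

/-- The linear functional `A ↦ tr A M` on the trace-class operators, which for `M` an effect is the
probability of that effect in the state `A`. -/
noncomputable def traceMul (M : E →L[ℂ] E) : traceClass E →ₗ[ℂ] ℂ where
  toFun A := trace ((A : E →L[ℂ] E) ∘L M)
  map_add' A B := by
    refine (hasSum_trace ⟨_, comp_mem_traceClass (A + B) M⟩).unique ?_
    simpa [inner_add_right] using (hasSum_trace ⟨_, comp_mem_traceClass A M⟩).add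
      (hasSum_trace ⟨_, comp_mem_traceClass B M⟩)
  map_smul' c A := by
    refine (hasSum_trace ⟨_, comp_mem_traceClass (c • A) M⟩).unique ?_
    simpa [inner_smul_right] using (hasSum_trace ⟨_, comp_mem_traceClass A M⟩).mul_left c

theorem traceMul_one (A : traceClass E) : traceMul 1 A = trace (A : E →L[ℂ] E) := rfl

end Trace

section Blocks

variable {H : Type*} [NormedAddCommGroup H] [InnerProductSpace ℂ H] {κ : Type}

open Classical in
/-- The embedding `φ ↦ φ ⊗ e_k`. -/
noncomputable def inj (k : κ) : H →L[ℂ] WithAncilla H κ :=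
  lp.singleContinuousLinearMap ℂ (fun _ : κ => H) 2 k

/-- The coordinate map `1 ⊗ ⟨e_k|`, the adjoint of `inj k`. -/
noncomputable def proj (k : κ) : WithAncilla H κ →L[ℂ] H := lp.evalCLM ℂ (fun _ : κ => H) 2 k

theorem inner_inj_left (k : κ) (a : H) (v : WithAncilla H κ) : ⟪inj k a, v⟫_ℂ = ⟪a, v k⟫_ℂ := by
  classical
  exact lp.inner_single_left (𝕜 := ℂ) k a v

theorem inner_inj_right (k : κ) (a : H) (v : WithAncilla H κ) : ⟪v, inj k a⟫_ℂ = ⟪v k, a⟫_ℂ := by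
  classical
  exact lp.inner_single_right (𝕜 := ℂ) k a v

open Classical in
theorem inj_apply (k l : κ) (a : H) : (inj k a : WithAncilla H κ) l = if l = k then a else 0 := by
  by_cases h : l = k
  · subst h
    simp [inj]
  · simp [inj, h]

theorem hasSum_inj (v : WithAncilla H κ) : HasSum (fun k => inj k (v k)) v := by
  classical
  exact lp.hasSum_single (by simp) v

variable [CompleteSpace H]

variable (H κ) in
theorem isParseval_inj :
    IsParseval (fun p : κ × basisIndex H => (inj p.1 (basis H p.2) : WithAncilla H κ)) := by
  intro v
  simp only [inner_inj_left]
  rw [ENNReal.tsum_prod', enorm_sq_eq_tsum]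
  exact tsum_congr fun k => isParseval_hilbertBasis (basis H) (v k)

theorem posTrace_eq_tsum_proj {A : WithAncilla H κ →L[ℂ] WithAncilla H κ} (hA : A.IsPositive) :
    posTrace A = ∑' k, posTrace (proj k ∘L A ∘L inj k) := by
  rw [posTrace_eq_tsum (isParseval_inj H κ) hA, ENNReal.tsum_prod']
  simp only [inner_inj_left]
  rfl

theorem coe_block (A : traceClass (WithAncilla H κ)) (k l : κ) :
    (block A k l : H →L[ℂ] H) =
      proj k ∘L (A : WithAncilla H κ →L[ℂ] WithAncilla H κ) ∘L inj l :=
  rfl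

theorem inner_block (A : traceClass (WithAncilla H κ)) (k l : κ) (x y : H) :
    ⟪x, (block A k l : H →L[ℂ] H) y⟫_ℂ =
      ⟪inj k x, (A : WithAncilla H κ →L[ℂ] WithAncilla H κ) (inj l y)⟫_ℂ := by
  rw [inner_inj_left]
  rfl

/-- The block map as a linear map. -/
noncomputable def blockLinear (k l : κ) : traceClass (WithAncilla H κ) →ₗ[ℂ] traceClass H where
  toFun A := block A k l
  map_add' _ _ := rfl
  map_smul' _ _ := rfl

theorem blockLinear_apply (A : traceClass (WithAncilla H κ)) (k l : κ) :
    blockLinear k l A = block A k l :=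
  rfl

/-- The finite block operator with block `b k l` at the positions `k, l ∈ F`, used to approximate
operators with prescribed blocks. -/
noncomputable def ofBlocks (F : Finset κ) (b : κ → κ → traceClass H) :
    traceClass (WithAncilla H κ) :=
  ∑ k ∈ F, ∑ l ∈ F, ⟨inj k ∘L (b k l : H →L[ℂ] H) ∘L proj l, comp_comp_mem_traceClass _ _ _⟩

theorem inner_ofBlocks (F : Finset κ) (b : κ → κ → traceClass H) (x y : WithAncilla H κ) :
    ⟪x, (ofBlocks F b : WithAncilla H κ →L[ℂ] WithAncilla H κ) y⟫_ℂ =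
      ∑ k ∈ F, ∑ l ∈ F, ⟪x k, (b k l : H →L[ℂ] H) (y l)⟫_ℂ := by
  simp only [ofBlocks, AddSubmonoidClass.coe_finsetSum, sum_apply, inner_sum]
  exact Finset.sum_congr rfl fun k _ => Finset.sum_congr rfl fun l _ => inner_inj_right k _ x

open Classical in
theorem block_ofBlocks (F : Finset κ) (b : κ → κ → traceClass H) (k l : κ) :
    block (ofBlocks F b) k l = if k ∈ F ∧ l ∈ F then b k l else 0 := by
  refine Subtype.ext (ContinuousLinearMap.ext fun y => ext_inner_left ℂ fun x => ?_)
  have hterm (k' l') :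
      ⟪if k' = k then x else 0, (b k' l' : H →L[ℂ] H) (if l' = l then y else 0)⟫_ℂ =
        if k' = k then if l' = l then ⟪x, (b k l : H →L[ℂ] H) y⟫_ℂ else 0 else 0 := by
    split_ifs with h h' <;> simp_all
  simp only [inner_block, inner_ofBlocks, inj_apply, hterm]
  by_cases hk : k ∈ F <;> by_cases hl : l ∈ F <;> simp [hk, hl]

theorem inner_sum_inj (A : traceClass (WithAncilla H κ)) (F : Finset κ) (x y : κ → H) :
    ⟪∑ k ∈ F, inj k (x k),
        (A : WithAncilla H κ →L[ℂ] WithAncilla H κ) (∑ l ∈ F, inj l (y l))⟫_ℂ =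
      ∑ k ∈ F, ∑ l ∈ F, ⟪x k, (block A k l : H →L[ℂ] H) (y l)⟫_ℂ := by
  simp only [map_sum, sum_inner, inner_sum, inner_block]
  exact Finset.sum_comm

theorem tendsto_sum_inner_block (A : traceClass (WithAncilla H κ)) (x y : WithAncilla H κ) :
    Tendsto (fun F : Finset κ => ∑ k ∈ F, ∑ l ∈ F, ⟪x k, (block A k l : H →L[ℂ] H) (y l)⟫_ℂ) atTop
      (𝓝 ⟪x, (A : WithAncilla H κ →L[ℂ] WithAncilla H κ) y⟫_ℂ) := by
  simp only [← inner_sum_inj A _ (fun k => x k) (fun k => y k)]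
  exact (hasSum_inj x).inner
    (((A : WithAncilla H κ →L[ℂ] WithAncilla H κ).continuous.tendsto _).comp (hasSum_inj y))

theorem ext_block {A B : traceClass (WithAncilla H κ)} (h : ∀ k l, block A k l = block B k l) :
    A = B := by
  refine Subtype.ext (ContinuousLinearMap.ext fun y => ext_inner_left ℂ fun x => ?_)
  have hlim := tendsto_sum_inner_block A x y
  simp only [h] at hlim
  exact tendsto_nhds_unique hlim (tendsto_sum_inner_block B x y)

theorem isPositive_iff_sum_inner_block_nonneg {A : traceClass (WithAncilla H κ)} :
    (A : WithAncilla H κ →L[ℂ] WithAncilla H κ).IsPositive ↔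
      ∀ (F : Finset κ) (x : κ → H),
        0 ≤ ∑ k ∈ F, ∑ l ∈ F, ⟪x k, (block A k l : H →L[ℂ] H) (x l)⟫_ℂ :=
  ⟨fun hA F x => inner_sum_inj A F x x ▸ hA.inner_nonneg_right _, fun h =>
    isPositive_iff_inner_nonneg.2 fun x =>
      ge_of_tendsto' (tendsto_sum_inner_block A x x) fun F => h F (fun k => x k)⟩

theorem isPositive_block {A : traceClass (WithAncilla H κ)}
    (hA : (A : WithAncilla H κ →L[ℂ] WithAncilla H κ).IsPositive) (k : κ) :
    (block A k k : H →L[ℂ] H).IsPositive :=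
  isPositive_iff_inner_nonneg.2 fun x => inner_block A k k x x ▸ hA.inner_nonneg_right _

theorem isPositive_ofBlocks {F : Finset κ} {b : κ → κ → traceClass H}
    (h : ∀ x : κ → H, 0 ≤ ∑ k ∈ F, ∑ l ∈ F, ⟪x k, (b k l : H →L[ℂ] H) (x l)⟫_ℂ) :
    (ofBlocks F b : WithAncilla H κ →L[ℂ] WithAncilla H κ).IsPositive :=
  isPositive_iff_inner_nonneg.2 fun x => inner_ofBlocks F b x x ▸ h fun k => x k

end Blocks

section WeakLimit

variable {E ι : Type*} [NormedAddCommGroup E] [InnerProductSpace ℂ E]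

theorem exists_tendsto_inner_ultrafilter (U : Ultrafilter ι) {B : ι → E →L[ℂ] E} {C : ℝ}
    (hB : ∀ i v, ‖B i v‖ ≤ C * ‖v‖) (x y : E) :
    ∃ z ∈ Metric.closedBall (0 : ℂ) (C * ‖x‖ * ‖y‖),
      Tendsto (fun i => ⟪x, B i y⟫_ℂ) U (𝓝 z) := by
  have hmem (i) : ⟪x, B i y⟫_ℂ ∈ Metric.closedBall (0 : ℂ) (C * ‖x‖ * ‖y‖) := by
    rw [mem_closedBall_zero_iff]
    calc ‖⟪x, B i y⟫_ℂ‖ ≤ ‖x‖ * (C * ‖y‖) :=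
          (norm_inner_le_norm _ _).trans (mul_le_mul_of_nonneg_left (hB i y) (norm_nonneg x))
      _ = C * ‖x‖ * ‖y‖ := by ring
  exact (isCompact_closedBall (0 : ℂ) (C * ‖x‖ * ‖y‖)).ultrafilter_le_nhds
    (U.map fun i => ⟪x, B i y⟫_ℂ) (le_principal_iff.2 (mem_map.2 (univ_mem' hmem)))

theorem exists_weak_limit [CompleteSpace E] (U : Ultrafilter ι) {B : ι → E →L[ℂ] E} {C : ℝ}
    (hB : ∀ i v, ‖B i v‖ ≤ C * ‖v‖) :
    ∃ T : E →L[ℂ] E, ∀ x y, Tendsto (fun i => ⟪x, B i y⟫_ℂ) U (𝓝 ⟪x, T y⟫_ℂ) := by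
  choose g hg hlim using exists_tendsto_inner_ultrafilter U hB
  have hunique {x y z} (h : Tendsto (fun i => ⟪x, B i y⟫_ℂ) U (𝓝 z)) : g x y = z :=
    tendsto_nhds_unique (hlim x y) h
  let S : E →L⋆[ℂ] E →L[ℂ] ℂ := LinearMap.mkContinuous₂
    (LinearMap.mk₂'ₛₗ (starRingEnd ℂ) (RingHom.id ℂ) g
      (fun x x' y => hunique (by simpa [inner_add_left] using (hlim x y).add (hlim x' y)))
      (fun c x y => hunique
        (by simpa [inner_smul_left, mul_comm] using (hlim x y).const_mul (starRingEnd ℂ c)))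
      (fun x y y' => hunique (by simpa [inner_add_right] using (hlim x y).add (hlim x y')))
      (fun c x y => hunique (by simpa [inner_smul_right] using (hlim x y).const_mul c)))
    C (fun x y => by simpa using hg x y)
  refine ⟨(InnerProductSpace.continuousLinearMapOfBilin S).adjoint, fun x y => ?_⟩
  rw [ContinuousLinearMap.adjoint_inner_right, InnerProductSpace.continuousLinearMapOfBilin_apply]
  exact hlim x y

end WeakLimit

section Ampliation

variable {H : Type*} [NormedAddCommGroup H] [InnerProductSpace ℂ H] [CompleteSpace H]
variable {H' : Type*} [NormedAddCommGroup H'] [InnerProductSpace ℂ H'] [CompleteSpace H']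
variable {κ : Type} {Λ : Superoperator H H'}

theorem isAmpliation_ofBlocks (Λ : Superoperator H H') (F : Finset κ) (b : κ → κ → traceClass H) :
    IsAmpliation Λ (ofBlocks F b) (ofBlocks F fun k l => Λ (b k l)) := by
  classical
  intro k l
  simp only [block_ofBlocks]
  split_ifs <;> simp

theorem ampliation_eq {A : traceClass (WithAncilla H κ)} {B : traceClass (WithAncilla H' κ)}
    (h : IsAmpliation Λ A B) : ampliation Λ A = B := by
  have hex : ∃ B, IsAmpliation Λ A B := ⟨B, h⟩
  rw [ampliation, dif_pos hex]
  exact ext_block fun k l => (hex.choose_spec k l).trans (h k l).symm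

/-- The functional `Λ ↦ ∑ ⟨x_k, Λ(A_kl) x_l⟩ = ⟨x, (Λ ⊗ I)(A) x⟩` for a vector `x` supported in a
finite set `F` of coordinates. Complete positivity is the nonnegativity of these functionals for
all `A ≥ 0`, which reduces statements about curves of maps to statements about scalar functions. -/
noncomputable def blockForm (F : Finset κ) (A : traceClass (WithAncilla H κ)) (x : κ → H') :
    Superoperator H H' →ₗ[ℂ] ℂ where
  toFun Λ := ∑ k ∈ F, ∑ l ∈ F, ⟪x k, (Λ (block A k l) : H' →L[ℂ] H') (x l)⟫_ℂ
  map_add' Λ Λ' := by simp [Finset.sum_add_distrib]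
  map_smul' c Λ := by simp [Finset.mul_sum]

theorem blockForm_apply (F : Finset κ) (A : traceClass (WithAncilla H κ)) (x : κ → H')
    (Λ : Superoperator H H') : blockForm F A x Λ =
      ∑ k ∈ F, ∑ l ∈ F, ⟪x k, (Λ (block A k l) : H' →L[ℂ] H') (x l)⟫_ℂ :=
  rfl

theorem IsCompletelyPositive.isPositive_ofBlocks_map [Countable κ] (hΛ : IsCompletelyPositive Λ)
    {A : traceClass (WithAncilla H κ)}
    (hA : (A : WithAncilla H κ →L[ℂ] WithAncilla H κ).IsPositive) (F : Finset κ) :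
    (ofBlocks F (fun k l => Λ (block A k l)) :
      WithAncilla H' κ →L[ℂ] WithAncilla H' κ).IsPositive :=
  hΛ κ _ _ (isAmpliation_ofBlocks Λ F (block A))
    (isPositive_ofBlocks (isPositive_iff_sum_inner_block_nonneg.1 hA F))

theorem isCompletelyPositive_iff_blockForm_nonneg :
    IsCompletelyPositive Λ ↔ ∀ (κ : Type) [Countable κ] (A : traceClass (WithAncilla H κ)),
      (A : WithAncilla H κ →L[ℂ] WithAncilla H κ).IsPositive →
        ∀ (F : Finset κ) (x : κ → H'), 0 ≤ blockForm F A x Λ := by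
  classical
  refine ⟨fun hΛ κ _ A hA F x => ?_, fun h κ _ A B hAB hA => ?_⟩
  · refine (isPositive_iff_sum_inner_block_nonneg.1 (hΛ.isPositive_ofBlocks_map hA F) F x).trans_eq
      (Finset.sum_congr rfl fun k hk => Finset.sum_congr rfl fun l hl => ?_)
    rw [block_ofBlocks, if_pos ⟨hk, hl⟩]
  · refine isPositive_iff_sum_inner_block_nonneg.2 fun F x => ?_
    simp only [hAB _ _]
    exact h κ A hA F x

theorem IsCompletelyPositive.isPositive_apply (hΛ : IsCompletelyPositive Λ) {a : traceClass H}
    (ha : (a : H →L[ℂ] H).IsPositive) : (Λ a : H' →L[ℂ] H').IsPositive := by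
  classical
  have hA : (ofBlocks {()} (fun _ _ : Unit => a) :
      WithAncilla H Unit →L[ℂ] WithAncilla H Unit).IsPositive :=
    isPositive_ofBlocks fun x => by simpa using ha.inner_nonneg_right (x ())
  refine isPositive_iff_inner_nonneg.2 fun x => ?_
  simpa [blockForm_apply, block_ofBlocks] using
    isCompletelyPositive_iff_blockForm_nonneg.1 hΛ Unit _ hA {()} fun _ => x

theorem IsCPTP.posTrace_apply (hΛ : IsCPTP Λ) {a : traceClass H} (ha : (a : H →L[ℂ] H).IsPositive) :
    posTrace (Λ a : H' →L[ℂ] H') = posTrace (a : H →L[ℂ] H) :=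
  (trace_eq_trace_iff (hΛ.1.isPositive_apply ha) ha).1 (hΛ.2 a)

theorem IsCPTP.tsum_posTrace_apply_block (hΛ : IsCPTP Λ) {A : traceClass (WithAncilla H κ)}
    (hA : (A : WithAncilla H κ →L[ℂ] WithAncilla H κ).IsPositive) :
    ∑' k, posTrace (Λ (block A k k) : H' →L[ℂ] H') =
      posTrace (A : WithAncilla H κ →L[ℂ] WithAncilla H κ) := by
  simp only [hΛ.posTrace_apply (isPositive_block hA _), posTrace_eq_tsum_proj hA, coe_block]

theorem IsCPTP.posTrace_ofBlocks_le [Countable κ] (hΛ : IsCPTP Λ)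
    {A : traceClass (WithAncilla H κ)}
    (hA : (A : WithAncilla H κ →L[ℂ] WithAncilla H κ).IsPositive) (F : Finset κ) :
    posTrace (ofBlocks F (fun k l => Λ (block A k l)) :
      WithAncilla H' κ →L[ℂ] WithAncilla H' κ) ≤
        posTrace (A : WithAncilla H κ →L[ℂ] WithAncilla H κ) := by
  classical
  rw [← hΛ.tsum_posTrace_apply_block hA, posTrace_eq_tsum_proj (hΛ.1.isPositive_ofBlocks_map hA F)]
  refine ENNReal.tsum_le_tsum fun k => ?_
  rw [← coe_block, block_ofBlocks]
  split_ifs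
  · rfl
  · simp [posTrace]

theorem IsCPTP.exists_isPositive_blocks_eq [Countable κ] (hΛ : IsCPTP Λ)
    {A : traceClass (WithAncilla H κ)}
    (hA : (A : WithAncilla H κ →L[ℂ] WithAncilla H κ).IsPositive) :
    ∃ T : WithAncilla H' κ →L[ℂ] WithAncilla H' κ, T.IsPositive ∧
      ∀ k l, proj k ∘L T ∘L inj l = (Λ (block A k l) : H' →L[ℂ] H') := by
  classical
  set B : Finset κ → WithAncilla H' κ →L[ℂ] WithAncilla H' κ :=
    fun F => ofBlocks F fun k l => Λ (block A k l)
  have hpos (F) : (B F).IsPositive := hΛ.1.isPositive_ofBlocks_map hA F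
  have hbound (F v) :
      ‖B F v‖ ≤ (posTrace (A : WithAncilla H κ →L[ℂ] WithAncilla H κ)).toReal * ‖v‖ := by
    have henorm := (enorm_apply_le_posTrace (hpos F) v).trans
      (mul_le_mul_left (hΛ.posTrace_ofBlocks_le hA F) _)
    simpa [ENNReal.toReal_mul] using
      ENNReal.toReal_mono (ENNReal.mul_lt_top (posTrace_lt_top hA) (by simp)).ne henorm
  obtain ⟨T, hT⟩ :=
    exists_weak_limit (Ultrafilter.of (atTop : Filter (Finset κ))) hbound
  refine ⟨T, isPositive_iff_inner_nonneg.2 fun x =>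
    ge_of_tendsto' (hT x x) fun F => (hpos F).inner_nonneg_right x, fun k l => ?_⟩
  refine ContinuousLinearMap.ext fun y => ext_inner_left ℂ fun x => ?_
  have hconst : ∀ᶠ F in (Ultrafilter.of (atTop : Filter (Finset κ)) : Filter (Finset κ)),
      ⟪inj k x, B F (inj l y)⟫_ℂ = ⟪x, (Λ (block A k l) : H' →L[ℂ] H') y⟫_ℂ := by
    filter_upwards [Ultrafilter.of_le _ (eventually_ge_atTop ({k, l} : Finset κ))] with F hF
    rw [← inner_block, block_ofBlocks, if_pos ⟨hF (by simp), hF (by simp)⟩]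
  exact (inner_inj_left k x (T (inj l y))).symm.trans
    (tendsto_nhds_unique (hT _ _) (tendsto_const_nhds.congr' (EventuallyEq.symm hconst)))

theorem IsCPTP.isAmpliation_ampliation [Countable κ] (hΛ : IsCPTP Λ)
    {A : traceClass (WithAncilla H κ)}
    (hA : (A : WithAncilla H κ →L[ℂ] WithAncilla H κ).IsPositive) :
    IsAmpliation Λ A (ampliation Λ A) := by
  obtain ⟨T, hTpos, hT⟩ := hΛ.exists_isPositive_blocks_eq hA
  have htrace : posTrace T < ∞ := by
    rw [posTrace_eq_tsum_proj hTpos]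
    simpa only [hT, hΛ.tsum_posTrace_apply_block hA] using posTrace_lt_top hA
  have hB : IsAmpliation Λ A ⟨T, mem_traceClass_of_isPositive hTpos htrace⟩ :=
    fun k l => Subtype.ext (hT k l)
  rwa [ampliation_eq hB]

theorem IsCPTP.isDensity_apply (hΛ : IsCPTP Λ) {ρ : traceClass H} (hρ : IsDensity ρ) :
    IsDensity (Λ ρ) :=
  ⟨hΛ.1.isPositive_apply hρ.1, (hΛ.2 ρ).trans hρ.2⟩

theorem IsCPTP.isDensity_ampliation [Countable κ] (hΛ : IsCPTP Λ)
    {ρ : traceClass (WithAncilla H κ)} (hρ : IsDensity ρ) : IsDensity (ampliation Λ ρ) := by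
  have hampl := hΛ.isAmpliation_ampliation hρ.1
  have hpos := hΛ.1 κ _ _ hampl hρ.1
  refine ⟨hpos, ((trace_eq_trace_iff hpos hρ.1).2 ?_).trans hρ.2⟩
  rw [posTrace_eq_tsum_proj hpos, ← hΛ.tsum_posTrace_apply_block hρ.1]
  simp only [← coe_block, hampl _ _]

theorem ampliation_sum_smul [Countable κ] {ι ι' : Type*} [Fintype ι] [Fintype ι'] (c : ι → ℂ)
    (d : ι' → ℂ) {Φ : ι' → Superoperator H H'} (hΦ : ∀ j, IsCPTP (Φ j))
    {A : ι → traceClass (WithAncilla H κ)}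
    (hA : ∀ i, (A i : WithAncilla H κ →L[ℂ] WithAncilla H κ).IsPositive) :
    ampliation (∑ j, d j • Φ j) (∑ i, c i • A i) =
      ∑ p : ι × ι', (c p.1 * d p.2) • ampliation (Φ p.2) (A p.1) := by
  refine ampliation_eq fun k l => ?_
  simp only [← blockLinear_apply, map_sum, map_smul]
  simp only [blockLinear_apply, (hΦ _).isAmpliation_ampliation (hA _) k l, LinearMap.sum_apply,
    LinearMap.smul_apply, Finset.smul_sum, smul_smul, Fintype.sum_prod_type]

end Ampliation

section Simulation

/-- `σ = ∑ p_i v_i` and `τ = ∑ p_i l_i v_i` for elements `v_i` of `D` (states, or operations), a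
probability vector `p` and a likelihood ratio `l` with `∑ p_i l_i² ≤ c`, that is, with
`χ²`-divergence at most `c - 1`. Whatever is done with `σ` and `τ` can then be done with a sample
of the classical label `i`. -/
def IsSimulation {V : Type*} [AddCommGroup V] [Module ℂ V] (D : V → Prop) (c : ℝ) (σ τ : V) :
    Prop :=
  ∃ (ι : Type) (_ : Fintype ι) (p l : ι → ℝ) (v : ι → V),
    (∀ i, 0 < p i) ∧ (∀ i, 0 ≤ l i) ∧ (∀ i, D (v i)) ∧ ∑ i, p i = 1 ∧
    ∑ i, p i * l i = 1 ∧ ∑ i, p i * l i ^ 2 ≤ c ∧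
    σ = ∑ i, (p i : ℂ) • v i ∧ τ = ∑ i, ((p i * l i : ℝ) : ℂ) • v i

section Module

variable {V W : Type*} [AddCommGroup V] [Module ℂ V] [AddCommGroup W] [Module ℂ W]

theorem IsSimulation.refl {D : V → Prop} {v : V} (hv : D v) : IsSimulation D 1 v v :=
  ⟨Unit, inferInstance, 1, 1, fun _ => v, by simp, by simp, fun _ => hv, by simp, by simp, by simp,
    by simp, by simp⟩

theorem IsSimulation.map {D : V → Prop} {D' : W → Prop} {c : ℝ} {σ τ : V}
    (h : IsSimulation D c σ τ) {Ξ : V →ₗ[ℂ] W} (hΞ : ∀ v, D v → D' (Ξ v)) :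
    IsSimulation D' c (Ξ σ) (Ξ τ) := by
  obtain ⟨ι, _, p, l, v, hp, hl, hv, hsum, hsum', hc, rfl, rfl⟩ := h
  exact ⟨ι, inferInstance, p, l, fun i => Ξ (v i), hp, hl, fun i => hΞ _ (hv i), hsum, hsum', hc,
    by simp, by simp⟩

/-- `x` and `y` are mixtures of `x ± r⁻¹ (y - x)` with weights `(1/2, 1/2)` and
`((1 + r)/2, (1 - r)/2)`: a fair coin against a biased one. -/
theorem isSimulation_of_forall_add_smul {D : V → Prop} {x y : V} {r : ℝ} (hr : 0 < r)
    (hr1 : r ≤ 1) (h : ∀ s : ℝ, |s| * r ≤ 1 → D (x + (s : ℂ) • (y - x))) :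
    IsSimulation D (1 + r ^ 2) x y := by
  have hrc : (r : ℂ) ≠ 0 := by exact_mod_cast hr.ne'
  have hinv : |r⁻¹| * r ≤ 1 := by rw [abs_inv, abs_of_pos hr, inv_mul_cancel₀ hr.ne']
  refine ⟨Bool, inferInstance, fun _ => 1 / 2, fun b => bif b then 1 + r else 1 - r,
    fun b => x + ((bif b then r⁻¹ else -r⁻¹ : ℝ) : ℂ) • (y - x),
    fun _ => by norm_num, ?_, ?_, ?_, ?_, ?_, ?_, ?_⟩
  · exact Bool.forall_bool.2 ⟨sub_nonneg.2 hr1, add_nonneg zero_le_one hr.le⟩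
  · exact Bool.forall_bool.2 ⟨h _ (by simpa using hinv), h _ hinv⟩
  all_goals simp only [Fintype.sum_bool, cond_true, cond_false]
  · norm_num
  · ring
  · exact le_of_eq (by ring)
  · push_cast
    module
  · push_cast
    match_scalars <;> field_simp <;> ring

end Module

variable {H : Type*} [NormedAddCommGroup H] [InnerProductSpace ℂ H] [CompleteSpace H]
variable {H' : Type*} [NormedAddCommGroup H'] [InnerProductSpace ℂ H'] [CompleteSpace H']

theorem IsSimulation.ampliation {κ : Type} [Countable κ] {c c' : ℝ}
    {σ τ : traceClass (WithAncilla H κ)} {Λ₀ Λ₁ : Superoperator H H'}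
    (h : IsSimulation IsDensity c σ τ) (h' : IsSimulation IsCPTP c' Λ₀ Λ₁) :
    IsSimulation IsDensity (c * c') (ampliation Λ₀ σ) (ampliation Λ₁ τ) := by
  obtain ⟨ι, _, p, l, ρ, hp, hl, hρ, hsum, hsuml, hc, rfl, rfl⟩ := h
  obtain ⟨ι', _, p', l', Φ, hp', hl', hΦ, hsum', hsuml', hc', rfl, rfl⟩ := h'
  simp only [ampliation_sum_smul _ _ hΦ fun i => (hρ i).1]
  refine ⟨ι × ι', inferInstance, fun q => p q.1 * p' q.2, fun q => l q.1 * l' q.2,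
    fun q => QuantumEstimation.ampliation (Φ q.2) (ρ q.1), fun q => mul_pos (hp _) (hp' _),
    fun q => mul_nonneg (hl _) (hl' _), fun q => (hΦ _).isDensity_ampliation (hρ _), ?_, ?_, ?_,
    ?_, ?_⟩
  · rw [Fintype.sum_prod_type, ← Fintype.sum_mul_sum, hsum, hsum', one_mul]
  · refine Eq.trans ?_ ((congrArg₂ (· * ·) hsuml hsuml').trans (one_mul 1))
    rw [Fintype.sum_mul_sum, Fintype.sum_prod_type]
    exact Fintype.sum_congr _ _ fun i => Fintype.sum_congr _ _ fun j => mul_mul_mul_comm _ _ _ _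
  · have hprod : ∑ q : ι × ι', p q.1 * p' q.2 * (l q.1 * l' q.2) ^ 2 =
        (∑ i, p i * l i ^ 2) * ∑ j, p' j * l' j ^ 2 := by
      rw [Fintype.sum_mul_sum, Fintype.sum_prod_type]
      exact Fintype.sum_congr _ _ fun i => Fintype.sum_congr _ _ fun j => by ring
    have hnonneg : 0 ≤ ∑ i, p i * l i ^ 2 :=
      Finset.sum_nonneg fun i _ => mul_nonneg (hp i).le (sq_nonneg _)
    rw [hprod]
    exact mul_le_mul hc hc' (Finset.sum_nonneg fun j _ => mul_nonneg (hp' j).le (sq_nonneg _))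
      (hnonneg.trans hc)
  · push_cast
    rfl
  · refine Fintype.sum_congr _ _ fun q => ?_
    rw [mul_mul_mul_comm, Complex.ofReal_mul (p q.1 * l q.1)]

theorem Estimator.isSimulation_output {m : ℕ} (e : Estimator H H' m) {c : ℝ}
    {Λ₀ Λ₁ : Superoperator H H'} (h : IsSimulation IsCPTP c Λ₀ Λ₁) {n : ℕ} (hn : 1 ≤ n) :
    IsSimulation IsDensity (c ^ n) (e.output (fun _ => Λ₀) n) (e.output (fun _ => Λ₁) n) := by
  have := e.countable
  obtain ⟨k, rfl⟩ := Nat.exists_eq_add_of_le' hn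
  change IsSimulation IsDensity _ (e.iterate (fun _ => Λ₀) k) (e.iterate (fun _ => Λ₁) k)
  clear hn
  induction k with
  | zero => simpa [iterate] using (IsSimulation.refl e.isDensity).ampliation h
  | succ k ih =>
    rw [pow_succ]
    exact (ih.map fun _ => (e.isCPTP k).isDensity_apply).ampliation h

end Simulation

section Outcome

variable {Ω : Type*} [MeasurableSpace Ω]
variable {E : Type*} [NormedAddCommGroup E] [InnerProductSpace ℂ E]

theorem POVM.op_empty (M : POVM Ω E) : M.op ∅ = 0 := by
  refine ContinuousLinearMap.ext fun y => ext_inner_left ℂ fun x => ?_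
  have hsum := M.hasSum_iUnion (fun _ => ∅) (fun _ => MeasurableSet.empty)
    (fun _ _ _ => disjoint_bot_left) x y
  simpa using
    (tendsto_nhds_unique hsum.summable.tendsto_atTop_zero tendsto_const_nhds).symm

/-- The measure `Δ ↦ ⟨x, M(Δ) x⟩`, the unnormalized distribution of the outcome in the pure state
`x`. -/
noncomputable def POVM.vectorMeasure (M : POVM Ω E) (x : E) : Measure Ω :=
  Measure.ofMeasurable (fun Δ _ => ENNReal.ofReal (RCLike.re ⟪x, M.op Δ x⟫_ℂ))
    (by simp [M.op_empty]) (by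
      intro Δ hΔ hd
      have hsum := (M.hasSum_iUnion Δ hΔ hd x x).mapL Complex.reCLM
      exact (congrArg ENNReal.ofReal hsum.tsum_eq.symm).trans (ENNReal.ofReal_tsum_of_nonneg
        (fun k => (M.isPositive _ (hΔ k)).re_inner_nonneg_right x) hsum.summable))

theorem POVM.vectorMeasure_apply (M : POVM Ω E) (x : E) {Δ : Set Ω} (hΔ : MeasurableSet Δ) :
    M.vectorMeasure x Δ = ENNReal.ofReal (RCLike.re ⟪x, M.op Δ x⟫_ℂ) :=
  Measure.ofMeasurable_apply Δ hΔ

theorem HasNuclearSum.comp_isSymmetric {ι : Type*} {A M : E →L[ℂ] E} {x y : ι → E}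
    (h : HasNuclearSum A x y) (hM : (M : E →ₗ[ℂ] E).IsSymmetric) :
    HasNuclearSum (A ∘L M) x (fun i => M (y i)) := by
  refine ⟨?_, fun v => (funext fun i => congrArg (· • x i) (hM (y i) v)) ▸ h.2 (M v)⟩
  refine (ENNReal.tsum_le_tsum fun i => ?_).trans_lt
    ((ENNReal.tsum_mul_left (a := ‖M‖ₑ)).trans_lt (ENNReal.mul_lt_top (by simp) h.1))
  calc ‖x i‖ₑ * ‖M (y i)‖ₑ ≤ ‖x i‖ₑ * (‖M‖ₑ * ‖y i‖ₑ) := by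
        gcongr
        exact M.le_opENorm _
    _ = ‖M‖ₑ * (‖x i‖ₑ * ‖y i‖ₑ) := by ring

variable [CompleteSpace E]

theorem HasNuclearSum.hasSum_re_traceMul {ι : Type*} {A : traceClass E} {M : E →L[ℂ] E}
    {x : ι → E} (h : HasNuclearSum (A : E →L[ℂ] E) x x) (hM : M.IsPositive) :
    HasSum (fun i => RCLike.re ⟪x i, M (x i)⟫_ℂ) (traceMul M A).re :=
  (funext fun i => congrArg RCLike.re (hM.isSymmetric (x i) (x i))) ▸
    (h.comp_isSymmetric hM.isSymmetric).hasSum_trace.mapL Complex.reCLM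

theorem traceMul_re_nonneg {ρ : traceClass E} (hρ : (ρ : E →L[ℂ] E).IsPositive) {M : E →L[ℂ] E}
    (hM : M.IsPositive) : 0 ≤ (traceMul M ρ).re := by
  obtain ⟨x, hx⟩ := exists_hasNuclearSum_self hρ (posTrace_lt_top hρ)
  exact (hx.hasSum_re_traceMul hM).nonneg fun i => hM.re_inner_nonneg_right (x i)

theorem outcomeMeasure_apply {ρ : traceClass E} (hρ : (ρ : E →L[ℂ] E).IsPositive) (M : POVM Ω E)
    {Δ : Set Ω} (hΔ : MeasurableSet Δ) :
    outcomeMeasure ρ M Δ = ENNReal.ofReal (traceMul (M.op Δ) ρ).re := by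
  obtain ⟨x, hx⟩ := exists_hasNuclearSum_self hρ (posTrace_lt_top hρ)
  have hex : ∃ μ : Measure Ω, ∀ Δ, MeasurableSet Δ →
      μ Δ = ENNReal.ofReal (trace ((ρ : E →L[ℂ] E) ∘L M.op Δ)).re := by
    refine ⟨Measure.sum fun i => M.vectorMeasure (x i), fun Δ hΔ => ?_⟩
    have hsum := hx.hasSum_re_traceMul (M.isPositive Δ hΔ)
    simp only [Measure.sum_apply _ hΔ, M.vectorMeasure_apply _ hΔ]
    exact (ENNReal.ofReal_tsum_of_nonneg (fun i => (M.isPositive Δ hΔ).re_inner_nonneg_right (x i))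
      hsum.summable).symm.trans (congrArg _ hsum.tsum_eq)
  rw [outcomeMeasure, dif_pos hex]
  exact hex.choose_spec Δ hΔ

theorem isProbabilityMeasure_outcomeMeasure {ρ : traceClass E} (hρ : IsDensity ρ) (M : POVM Ω E) :
    IsProbabilityMeasure (outcomeMeasure ρ M) :=
  ⟨by simp [outcomeMeasure_apply hρ.1 M MeasurableSet.univ, M.op_univ, traceMul_one, hρ.2]⟩

theorem outcomeMeasure_sum_smul {ι : Type*} [Fintype ι] {c : ι → ℝ} (hc : ∀ i, 0 ≤ c i)
    {ρ : ι → traceClass E} (hρ : ∀ i, (ρ i : E →L[ℂ] E).IsPositive) (M : POVM Ω E) :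
    outcomeMeasure (∑ i, (c i : ℂ) • ρ i) M =
      ∑ i, ENNReal.ofReal (c i) • outcomeMeasure (ρ i) M := by
  have hpos : ((∑ i, (c i : ℂ) • ρ i : traceClass E) : E →L[ℂ] E).IsPositive := by
    simpa using isPositive_sum_smul Finset.univ (fun i _ => hc i) fun i _ => hρ i
  refine Measure.ext fun Δ hΔ => ?_
  simp only [outcomeMeasure_apply hpos M hΔ, map_sum, map_smul, smul_eq_mul, Complex.re_sum,
    Complex.re_ofReal_mul, Measure.finsetSum_apply, Measure.smul_apply,
    outcomeMeasure_apply (hρ _) M hΔ, ← ENNReal.ofReal_mul (hc _)]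
  exact ENNReal.ofReal_sum_of_nonneg fun i _ =>
    mul_nonneg (hc i) (traceMul_re_nonneg (hρ i) (M.isPositive Δ hΔ))

end Outcome

section ChapmanRobbins

theorem sq_sum_mul_sub_sum_le {ι : Type*} [Fintype ι] {p l : ι → ℝ} (hp : ∀ i, 0 ≤ p i)
    (hsum : ∑ i, p i = 1) (hsuml : ∑ i, p i * l i = 1) (a : ι → ℝ) :
    (∑ i, p i * l i * a i - ∑ i, p i * a i) ^ 2 ≤
      (∑ i, p i * l i ^ 2 - 1) * ∑ i, p i * a i ^ 2 := by
  have hchisq : ∑ i, p i * (l i - 1) ^ 2 = ∑ i, p i * l i ^ 2 - 1 := by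
    have hexpand (i) : p i * (l i - 1) ^ 2 = p i * l i ^ 2 - 2 * (p i * l i) + p i := by ring
    simp only [hexpand, Finset.sum_add_distrib, Finset.sum_sub_distrib, ← Finset.mul_sum, hsum,
      hsuml]
    ring
  rw [← hchisq, ← Finset.sum_sub_distrib]
  exact Finset.sum_sq_le_sum_mul_sum_of_sq_le_mul _ (fun i _ => mul_nonneg (hp i) (sq_nonneg _))
    (fun i _ => mul_nonneg (hp i) (sq_nonneg _)) fun i _ => le_of_eq (by ring)

variable {Ω : Type*} [MeasurableSpace Ω]

theorem sq_integral_le_integral_sq {μ : Measure Ω} [IsProbabilityMeasure μ] {f : Ω → ℝ}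
    (hf : MemLp f 2 μ) : (∫ ω, f ω ∂μ) ^ 2 ≤ ∫ ω, f ω ^ 2 ∂μ := by
  have hvar := ProbabilityTheory.variance_nonneg f μ
  rw [ProbabilityTheory.variance_eq_sub hf] at hvar
  simpa using hvar

variable {ι : Type*} [Fintype ι] {μ : ι → Measure Ω} {F : Type*} [NormedAddCommGroup F]

theorem memLp_of_memLp_sum_smul {c : ι → ℝ≥0∞} {f : Ω → F} {q : ℝ≥0∞}
    (hf : MemLp f q (∑ i, c i • μ i)) {i : ι} (hc : c i ≠ 0) (hc' : c i ≠ ∞) :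
    MemLp f q (μ i) := by
  have hle : c i • μ i ≤ ∑ i, c i • μ i :=
    Finset.single_le_sum (f := fun i => c i • μ i) (fun _ _ => Measure.zero_le _)
      (Finset.mem_univ i)
  have hsmul := (hf.mono_measure hle).smul_measure (ENNReal.inv_ne_top.2 hc)
  rwa [smul_smul, ENNReal.inv_mul_cancel hc hc', one_smul] at hsmul

theorem integrable_sum_ofReal_smul {f : Ω → F} (hf : ∀ i, Integrable f (μ i)) (c : ι → ℝ) :
    Integrable f (∑ i, ENNReal.ofReal (c i) • μ i) :=
  integrable_finsetSum_measure.2 fun i _ => (hf i).smul_measure ENNReal.ofReal_ne_top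

theorem integral_sum_ofReal_smul {f : Ω → ℝ} (hf : ∀ i, Integrable f (μ i)) {c : ι → ℝ}
    (hc : ∀ i, 0 ≤ c i) :
    ∫ ω, f ω ∂(∑ i, ENNReal.ofReal (c i) • μ i) = ∑ i, c i * ∫ ω, f ω ∂μ i := by
  rw [integral_finsetSum_measure fun i _ => (hf i).smul_measure ENNReal.ofReal_ne_top]
  simp only [integral_smul_measure, ENNReal.toReal_ofReal (hc _), smul_eq_mul]

theorem sq_integral_mixture_sub_le [∀ i, IsProbabilityMeasure (μ i)] {p l : ι → ℝ}
    (hp : ∀ i, 0 ≤ p i) (hl : ∀ i, 0 ≤ l i) (hsum : ∑ i, p i = 1) (hsuml : ∑ i, p i * l i = 1)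
    {f : Ω → ℝ} (hf : ∀ i, MemLp f 2 (μ i)) :
    (∫ ω, f ω ∂(∑ i, ENNReal.ofReal (p i * l i) • μ i) -
        ∫ ω, f ω ∂(∑ i, ENNReal.ofReal (p i) • μ i)) ^ 2 ≤
      (∑ i, p i * l i ^ 2 - 1) * ∫ ω, f ω ^ 2 ∂(∑ i, ENNReal.ofReal (p i) • μ i) := by
  have hint (i) : Integrable f (μ i) := (hf i).integrable one_le_two
  rw [integral_sum_ofReal_smul hint fun i => mul_nonneg (hp i) (hl i),
    integral_sum_ofReal_smul hint hp, integral_sum_ofReal_smul (fun i => (hf i).integrable_sq) hp]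
  have hchisq : 0 ≤ ∑ i, p i * l i ^ 2 - 1 := by
    simpa [hsum, hsuml] using (sq_nonneg _).trans (sq_sum_mul_sub_sum_le hp hsum hsuml 1)
  refine (sq_sum_mul_sub_sum_le hp hsum hsuml _).trans ?_
  gcongr with i
  · exact hp i
  · exact sq_integral_le_integral_sq (hf i)

variable {E : Type*} [NormedAddCommGroup E] [InnerProductSpace ℂ E] [CompleteSpace E]

theorem IsSimulation.exists_outcomeMeasure_eq {c : ℝ} {σ τ : traceClass E}
    (h : IsSimulation IsDensity c σ τ) (M : POVM Ω E) :
    ∃ (ι : Type) (_ : Fintype ι) (p l : ι → ℝ) (μ : ι → Measure Ω),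
      (∀ i, 0 < p i) ∧ (∀ i, 0 ≤ l i) ∧ (∀ i, IsProbabilityMeasure (μ i)) ∧ ∑ i, p i = 1 ∧
      ∑ i, p i * l i = 1 ∧ ∑ i, p i * l i ^ 2 ≤ c ∧
      outcomeMeasure σ M = ∑ i, ENNReal.ofReal (p i) • μ i ∧
      outcomeMeasure τ M = ∑ i, ENNReal.ofReal (p i * l i) • μ i := by
  obtain ⟨ι, _, p, l, ρ, hp, hl, hρ, hsum, hsuml, hc, rfl, rfl⟩ := h
  exact ⟨ι, inferInstance, p, l, fun i => outcomeMeasure (ρ i) M, hp, hl,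
    fun i => isProbabilityMeasure_outcomeMeasure (hρ i) M, hsum, hsuml, hc,
    outcomeMeasure_sum_smul (fun i => (hp i).le) (fun i => (hρ i).1) M,
    outcomeMeasure_sum_smul (fun i => mul_nonneg (hp i).le (hl i)) (fun i => (hρ i).1) M⟩

theorem IsSimulation.integrable_outcomeMeasure {c : ℝ} {σ τ : traceClass E}
    (h : IsSimulation IsDensity c σ τ) (M : POVM Ω E) {f : Ω → F}
    (hf : MemLp f 2 (outcomeMeasure σ M)) : Integrable f (outcomeMeasure τ M) := by
  obtain ⟨ι, _, p, l, μ, hp, -, _, -, -, -, hσ, hτ⟩ := h.exists_outcomeMeasure_eq M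
  rw [hτ]
  exact integrable_sum_ofReal_smul (fun i =>
    (memLp_of_memLp_sum_smul (hσ ▸ hf) (by simpa using hp i) (by simp)).integrable one_le_two) _

theorem IsSimulation.sq_integral_sub_le {c : ℝ} {σ τ : traceClass E}
    (h : IsSimulation IsDensity c σ τ) (M : POVM Ω E) {f : Ω → ℝ}
    (hf : MemLp f 2 (outcomeMeasure σ M)) :
    (∫ ω, f ω ∂(outcomeMeasure τ M) - ∫ ω, f ω ∂(outcomeMeasure σ M)) ^ 2 ≤
      (c - 1) * ∫ ω, f ω ^ 2 ∂(outcomeMeasure σ M) := by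
  obtain ⟨ι, _, p, l, μ, hp, hl, _, hsum, hsuml, hc, hσ, hτ⟩ := h.exists_outcomeMeasure_eq M
  have hμ (i) : MemLp f 2 (μ i) :=
    memLp_of_memLp_sum_smul (hσ ▸ hf) (by simpa using hp i) (by simp)
  rw [hσ, hτ]
  refine (sq_integral_mixture_sub_le (fun i => (hp i).le) hl hsum hsuml hμ).trans ?_
  gcongr

end ChapmanRobbins

section CompletelyBounded

variable {H : Type*} [NormedAddCommGroup H] [InnerProductSpace ℂ H] [CompleteSpace H]
variable {H' : Type*} [NormedAddCommGroup H'] [InnerProductSpace ℂ H'] [CompleteSpace H']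

theorem traceNorm_smul (c : ℂ) (A : H →L[ℂ] H) : traceNorm (c • A) = ‖c‖ₑ * traceNorm A := by
  have hbasis (i) : ⟪basis H i, (‖c‖ • CFC.abs A) (basis H i)⟫_ℂ =
      ((‖c‖ : ℝ) : ℂ) * ⟪basis H i, CFC.abs A (basis H i)⟫_ℂ :=
    inner_smul_real_right _ _ _
  simp only [traceNorm, CFC.abs_smul, posTrace, hbasis, ← ENNReal.tsum_mul_left, ← ofReal_norm,
    ← ENNReal.ofReal_mul (norm_nonneg c), RCLike.re_to_complex, Complex.re_ofReal_mul]

theorem eq_zero_of_traceNorm_eq_zero {A : H →L[ℂ] H} (hA : traceNorm A = 0) : A = 0 :=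
  ContinuousLinearMap.ext fun v => by simpa [hA] using enorm_apply_le_traceNorm A v

variable {κ : Type} [Countable κ]

theorem traceNorm_le_cbNorm {Ψ : Superoperator H H'} {X : traceClass (WithAncilla H κ)}
    {B : traceClass (WithAncilla H' κ)} (h : IsAmpliation Ψ X B)
    (hX : traceNorm (X : WithAncilla H κ →L[ℂ] WithAncilla H κ) = 1) :
    traceNorm (B : WithAncilla H' κ →L[ℂ] WithAncilla H' κ) ≤ cbNorm Ψ := by
  refine le_iSup_of_le κ (le_iSup_of_le ‹_› (le_iSup_of_le X (le_iSup_of_le hX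
    (le_iInf₂ fun B' hB' => ?_))))
  rw [ext_block fun k l => (h k l).trans (hB' k l).symm]

theorem traceNorm_le_cbNorm_mul {Ψ : Superoperator H H'} {X : traceClass (WithAncilla H κ)}
    {B : traceClass (WithAncilla H' κ)} (h : IsAmpliation Ψ X B) :
    traceNorm (B : WithAncilla H' κ →L[ℂ] WithAncilla H' κ) ≤
      cbNorm Ψ * traceNorm (X : WithAncilla H κ →L[ℂ] WithAncilla H κ) := by
  set N := traceNorm (X : WithAncilla H κ →L[ℂ] WithAncilla H κ)
  rcases eq_or_ne N 0 with hN0 | hN0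
  · have hX : X = 0 := Subtype.ext (eq_zero_of_traceNorm_eq_zero hN0)
    have hB : B = 0 := ext_block fun k l => by
      rw [h k l, hX, ← blockLinear_apply, map_zero, map_zero, ← blockLinear_apply, map_zero]
    simp [hB, traceNorm, posTrace]
  · have hNtop : N ≠ ∞ := X.2.ne
    set c : ℂ := ((N.toReal⁻¹ : ℝ) : ℂ)
    have hc : ‖c‖ₑ = N⁻¹ := by
      rw [← ofReal_norm, Complex.norm_real, Real.norm_of_nonneg (by positivity),
        ENNReal.ofReal_inv_of_pos (ENNReal.toReal_pos hN0 hNtop), ENNReal.ofReal_toReal hNtop]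
    have hsmul : IsAmpliation Ψ (c • X) (c • B) := fun k l => by
      rw [← blockLinear_apply, ← blockLinear_apply, map_smul, map_smul, map_smul,
        blockLinear_apply, blockLinear_apply, h k l]
    have hle := traceNorm_le_cbNorm hsmul (by
      rw [Submodule.coe_smul, traceNorm_smul, hc, ENNReal.inv_mul_cancel hN0 hNtop])
    rwa [Submodule.coe_smul, traceNorm_smul, hc, ENNReal.inv_mul_le_iff hN0 hNtop, mul_comm] at hle

theorem exists_enorm_blockForm_le_mul_cbNorm (F : Finset κ) (A : traceClass (WithAncilla H κ))
    (x : κ → H') :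
    ∃ C : ℝ≥0∞, C ≠ ∞ ∧ ∀ Ψ : Superoperator H H', ‖blockForm F A x Ψ‖ₑ ≤ C * cbNorm Ψ := by
  classical
  set X := ofBlocks F (block A)
  set v : WithAncilla H' κ := ∑ k ∈ F, inj k (x k)
  refine ⟨‖v‖ₑ * (traceNorm (X : WithAncilla H κ →L[ℂ] WithAncilla H κ) * ‖v‖ₑ),
    ENNReal.mul_ne_top (by simp) (ENNReal.mul_ne_top X.2.ne (by simp)), fun Ψ => ?_⟩
  set B := ofBlocks F fun k l => Ψ (block A k l)
  have hform : blockForm F A x Ψ =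
      ⟪v, (B : WithAncilla H' κ →L[ℂ] WithAncilla H' κ) v⟫_ℂ := by
    rw [inner_sum_inj]
    exact Finset.sum_congr rfl fun k hk => Finset.sum_congr rfl fun l hl => by
      rw [block_ofBlocks, if_pos ⟨hk, hl⟩]
  calc ‖blockForm F A x Ψ‖ₑ
      ≤ ‖v‖ₑ * ‖(B : WithAncilla H' κ →L[ℂ] WithAncilla H' κ) v‖ₑ := by
        rw [hform]
        exact enorm_inner_le _ _
    _ ≤ ‖v‖ₑ * (cbNorm Ψ * traceNorm (X : WithAncilla H κ →L[ℂ] WithAncilla H κ) * ‖v‖ₑ) := by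
        gcongr
        exact (enorm_apply_le_traceNorm _ v).trans
          (mul_le_mul_left (traceNorm_le_cbNorm_mul (isAmpliation_ofBlocks Ψ F (block A))) _)
    _ = _ := by ring

/-- `D` is the derivative at `s` of the curve `Γ`, the limit being taken in the norm `‖·‖_cb`. -/
def HasCbDerivAt (Γ : ℝ → Superoperator H H') (D : Superoperator H H') (s : ℝ) : Prop :=
  Tendsto (fun t : ℝ => cbNorm (((t⁻¹ : ℝ) : ℂ) • (Γ (s + t) - Γ s) - D)) (𝓝[≠] 0) (𝓝 0)

theorem HasPartialDerivAt.hasCbDerivAt {m : ℕ} {Λ : Param m → Superoperator H H'} {i : Fin m}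
    {D : Superoperator H H'} {θ : Param m} {s : ℝ}
    (h : HasPartialDerivAt Λ i D (θ + s • EuclideanSpace.single i (1 : ℝ))) :
    HasCbDerivAt (fun s => Λ (θ + s • EuclideanSpace.single i (1 : ℝ))) D s := by
  simpa only [HasCbDerivAt, HasPartialDerivAt, add_smul, add_assoc] using h

theorem HasCbDerivAt.hasDerivAt_blockForm {Γ : ℝ → Superoperator H H'} {D : Superoperator H H'}
    {s : ℝ} (h : HasCbDerivAt Γ D s) (F : Finset κ) (A : traceClass (WithAncilla H κ))
    (x : κ → H') : HasDerivAt (fun t => blockForm F A x (Γ t)) (blockForm F A x D) s := by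
  obtain ⟨C, hC, hle⟩ := exists_enorm_blockForm_le_mul_cbNorm F A x (H := H)
  rw [hasDerivAt_iff_tendsto_slope_zero, tendsto_iff_edist_tendsto_0]
  have hlim := ENNReal.Tendsto.const_mul h (Or.inr hC)
  rw [mul_zero] at hlim
  refine tendsto_of_tendsto_of_tendsto_of_le_of_le tendsto_const_nhds hlim (fun _ => zero_le)
    fun t => le_of_eq_of_le ?_ (hle _)
  rw [edist_eq_enorm_sub, map_sub (blockForm F A x), map_smul, map_sub (blockForm F A x),
    Complex.coe_smul]

end CompletelyBounded

section Interior

theorem abs_sub_le_exp_sub_one_mul {u u' : ℝ → ℝ} {K t : ℝ} (hK : 0 < K) (ht : 0 ≤ t)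
    (hu : ∀ s ∈ Set.Icc 0 t, HasDerivAt u (u' s) s) (hu' : ∀ s ∈ Set.Icc 0 t, |u' s| ≤ K * u s) :
    |u t - u 0| ≤ (Real.exp (K * t) - 1) * u 0 := by
  have hgronwall := norm_le_gronwallBound_of_norm_deriv_right_le (f := fun s => u s - u 0)
    (f' := u') (δ := 0) (K := K) (ε := K * u 0)
    (fun s hs => ((hu s hs).sub_const _).continuousAt.continuousWithinAt)
    (fun s hs => ((hu s (Set.Ico_subset_Icc_self hs)).sub_const _).hasDerivWithinAt) (by simp)
    (fun s hs => (hu' s (Set.Ico_subset_Icc_self hs)).trans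
      (by nlinarith [le_abs_self (u s - u 0), Real.norm_eq_abs (u s - u 0)]))
    t (Set.right_mem_Icc.2 ht)
  simpa only [gronwallBound_of_K_ne_0 hK.ne', zero_mul, zero_add, mul_div_cancel_left₀ _ hK.ne',
    sub_zero, Real.norm_eq_abs, mul_comm (u 0)] using hgronwall

variable {H : Type*} [NormedAddCommGroup H] [InnerProductSpace ℂ H] [CompleteSpace H]
variable {H' : Type*} [NormedAddCommGroup H'] [InnerProductSpace ℂ H'] [CompleteSpace H']

/-- At the parameter `s`, the curve `Γ` passes through an operation with velocity `D`, and one can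
move from there by `δ` in both directions along `D` within the completely positive maps. -/
structure HasInteriorTangentAt (Γ : ℝ → Superoperator H H') (D : Superoperator H H') (δ s : ℝ) :
    Prop where
  isCPTP : IsCPTP (Γ s)
  hasCbDerivAt : HasCbDerivAt Γ D s
  isCompletelyPositive : ∀ r : ℝ, |r| ≤ δ → IsCompletelyPositive (Γ s + (r : ℂ) • D)

variable {Γ Γ' : ℝ → Superoperator H H'} {δ t : ℝ}

theorem HasInteriorTangentAt.abs_re_blockForm_le {D : Superoperator H H'} {s : ℝ}
    (h : HasInteriorTangentAt Γ D δ s) (hδ : 0 < δ) {κ : Type} [Countable κ]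
    {A : traceClass (WithAncilla H κ)} (hA : (A : WithAncilla H κ →L[ℂ] WithAncilla H κ).IsPositive)
    (F : Finset κ) (x : κ → H') :
    |(blockForm F A x D).re| ≤ δ⁻¹ * (blockForm F A x (Γ s)).re := by
  have hnonneg {r : ℝ} (hr : |r| ≤ δ) :
      0 ≤ (blockForm F A x (Γ s)).re + r * (blockForm F A x D).re := by
    have hform := (Complex.nonneg_iff.1 (isCompletelyPositive_iff_blockForm_nonneg.1
      (h.isCompletelyPositive r hr) κ A hA F x)).1
    rwa [map_add, map_smul, smul_eq_mul, Complex.add_re, Complex.re_ofReal_mul] at hform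
  have hplus := hnonneg (abs_of_pos hδ).le
  have hminus := hnonneg ((abs_neg δ).trans (abs_of_pos hδ)).le
  refine (le_inv_mul_iff₀ hδ).2 ?_
  rcases abs_cases (blockForm F A x D).re with ⟨habs, -⟩ | ⟨habs, -⟩ <;> rw [habs] <;> linarith

theorem isCompletelyPositive_add_smul_sub (hδ : 0 < δ) (ht : 0 ≤ t)
    (h : ∀ s ∈ Set.Icc 0 t, HasInteriorTangentAt Γ (Γ' s) δ s) {r : ℝ}
    (hr : |r| * (Real.exp (t / δ) - 1) ≤ 1) :
    IsCompletelyPositive (Γ 0 + (r : ℂ) • (Γ t - Γ 0)) := by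
  refine isCompletelyPositive_iff_blockForm_nonneg.2 fun κ _ A hA F x => ?_
  have hnonneg {s : ℝ} (hs : s ∈ Set.Icc 0 t) : 0 ≤ blockForm F A x (Γ s) :=
    isCompletelyPositive_iff_blockForm_nonneg.1 (h s hs).isCPTP.1 κ A hA F x
  obtain ⟨hre₀, him₀⟩ := Complex.nonneg_iff.1 (hnonneg (Set.left_mem_Icc.2 ht))
  obtain ⟨-, himt⟩ := Complex.nonneg_iff.1 (hnonneg (Set.right_mem_Icc.2 ht))
  have hgronwall := abs_sub_le_exp_sub_one_mul (inv_pos.2 hδ) ht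
    (fun s hs => Complex.reCLM.hasFDerivAt.comp_hasDerivAt s
      ((h s hs).hasCbDerivAt.hasDerivAt_blockForm F A x))
    fun s hs => (h s hs).abs_re_blockForm_le hδ hA F x
  simp only [Function.comp_apply, Complex.reCLM_apply, inv_mul_eq_div] at hgronwall
  have hmul : |r * ((blockForm F A x (Γ t)).re - (blockForm F A x (Γ 0)).re)| ≤
      (blockForm F A x (Γ 0)).re := by
    rw [abs_mul]
    calc _ ≤ |r| * ((Real.exp (t / δ) - 1) * (blockForm F A x (Γ 0)).re) := by gcongr
      _ = |r| * (Real.exp (t / δ) - 1) * (blockForm F A x (Γ 0)).re := (mul_assoc _ _ _).symm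
      _ ≤ (blockForm F A x (Γ 0)).re := mul_le_of_le_one_left hre₀ hr
  rw [map_add, map_smul, map_sub (blockForm F A x), smul_eq_mul, Complex.nonneg_iff]
  simp only [Complex.add_re, Complex.add_im, Complex.re_ofReal_mul, Complex.im_ofReal_mul,
    Complex.sub_re, Complex.sub_im]
  exact ⟨by linarith [(abs_le.1 hmul).1], by rw [← him₀, ← himt]; simp⟩

theorem IsCPTP.add_smul_sub {Λ Λ' : Superoperator H H'} (hΛ : IsCPTP Λ) (hΛ' : IsCPTP Λ') {c : ℂ}
    (h : IsCompletelyPositive (Λ + c • (Λ' - Λ))) : IsCPTP (Λ + c • (Λ' - Λ)) := by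
  refine ⟨h, fun A => ?_⟩
  simp only [← traceMul_one, LinearMap.add_apply, LinearMap.smul_apply, LinearMap.sub_apply,
    map_add, map_smul, map_sub]
  simp only [traceMul_one, hΛ.2 A, hΛ'.2 A, sub_self, smul_zero, add_zero]

theorem isSimulation_of_hasInteriorTangentAt (hδ : 0 < δ) (ht : 0 < t)
    (ht' : Real.exp (t / δ) - 1 ≤ 1) (h : ∀ s ∈ Set.Icc 0 t, HasInteriorTangentAt Γ (Γ' s) δ s) :
    IsSimulation IsCPTP (1 + (Real.exp (t / δ) - 1) ^ 2) (Γ 0) (Γ t) :=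
  isSimulation_of_forall_add_smul (sub_pos.2 (Real.one_lt_exp_iff.2 (div_pos ht hδ))) ht'
    fun _ hr => (h 0 (Set.left_mem_Icc.2 ht.le)).isCPTP.add_smul_sub
      (h t (Set.right_mem_Icc.2 ht.le)).isCPTP (isCompletelyPositive_add_smul_sub hδ ht.le h hr)

end Interior

section CramerRao

theorem tendsto_exp_sub_one_div (δ : ℝ) :
    Tendsto (fun t => (Real.exp (t / δ) - 1) / t) (𝓝[≠] 0) (𝓝 δ⁻¹) := by
  have hderiv : HasDerivAt (fun t => Real.exp (t / δ)) δ⁻¹ 0 := by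
    simpa using ((hasDerivAt_id (0 : ℝ)).div_const δ).exp
  refine (hasDerivAt_iff_tendsto_slope_zero.1 hderiv).congr fun t => ?_
  simp [div_eq_inv_mul]

theorem tendsto_one_add_sq_pow_sub_one_div_sq (δ : ℝ) (n : ℕ) :
    Tendsto (fun t => ((1 + (Real.exp (t / δ) - 1) ^ 2) ^ n - 1) / t ^ 2) (𝓝[≠] 0)
      (𝓝 (n / δ ^ 2)) := by
  have hsum : Tendsto (fun t => ∑ k ∈ Finset.range n, (1 + (Real.exp (t / δ) - 1) ^ 2) ^ k)
      (𝓝[≠] 0) (𝓝 (n : ℝ)) := by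
    have hcont : Continuous fun t =>
        ∑ k ∈ Finset.range n, (1 + (Real.exp (t / δ) - 1) ^ 2) ^ k := by fun_prop
    simpa using (hcont.tendsto 0).mono_left nhdsWithin_le_nhds
  have hlim := hsum.mul ((tendsto_exp_sub_one_div δ).pow 2)
  rw [inv_pow, ← div_eq_mul_inv] at hlim
  refine hlim.congr fun t => ?_
  rw [← geom_sum_mul, add_sub_cancel_left, div_pow, mul_div_assoc]

theorem sq_deriv_le_of_tendsto {g h : ℝ → ℝ} {g' L : ℝ} (hg : HasDerivAt g g' 0)
    (hle : ∀ᶠ t in 𝓝[>] 0, (g t - g 0) ^ 2 ≤ h t)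
    (hh : Tendsto (fun t => h t / t ^ 2) (𝓝[>] 0) (𝓝 L)) : g' ^ 2 ≤ L := by
  have hslope := (hasDerivAt_iff_tendsto_slope_zero.1 hg).mono_left (nhdsGT_le_nhdsNE 0)
  refine le_of_tendsto_of_tendsto (hslope.pow 2) hh (hle.mono fun t ht => ?_)
  simp only [zero_add, smul_eq_mul, ← div_eq_inv_mul, div_pow]
  gcongr

variable {H : Type*} [NormedAddCommGroup H] [InnerProductSpace ℂ H] [CompleteSpace H]
variable {H' : Type*} [NormedAddCommGroup H'] [InnerProductSpace ℂ H'] [CompleteSpace H']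
variable {m : ℕ}

namespace Estimator

theorem isDensity_output (e : Estimator H H' m) {Λ : Superoperator H H'} (hΛ : IsCPTP Λ) (n : ℕ) :
    IsDensity (e.output (fun _ => Λ) n) := by
  have := e.countable
  unfold output
  induction n - 1 with
  | zero => exact hΛ.isDensity_ampliation e.isDensity
  | succ k ih => exact hΛ.isDensity_ampliation ((e.isCPTP k).isDensity_apply ih)

theorem isProbabilityMeasure_law (e : Estimator H H' m) {Λ : Superoperator H H'} (hΛ : IsCPTP Λ)
    (n : ℕ) : IsProbabilityMeasure (e.law Λ n) :=
  isProbabilityMeasure_outcomeMeasure (e.isDensity_output hΛ n) e.M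

theorem integral_inner_sub (e : Estimator H H' m) {Λ : Superoperator H H'} (hΛ : IsCPTP Λ) {n : ℕ}
    {θ : Param m} (hT : Integrable (fun ω => e.T ω - θ) (e.law Λ n)) (w : Param m) :
    ∫ ω, ⟪w, e.T ω - θ⟫_ℝ ∂(e.law Λ n) = ⟪w, e.expectation Λ n⟫_ℝ - ⟪w, θ⟫_ℝ := by
  have := e.isProbabilityMeasure_law hΛ n
  have hint : Integrable e.T (e.law Λ n) :=
    (hT.add (integrable_const θ)).congr (ae_of_all _ fun ω => sub_add_cancel (e.T ω) θ)
  rw [integral_inner hT, integral_sub hint (integrable_const θ), integral_const, probReal_univ,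
    one_smul, inner_sub_right, expectation]

theorem sq_inner_expectation_sub_le (e : Estimator H H' m) {Λ₀ Λ₁ : Superoperator H H'} {c : ℝ}
    (h₀ : IsCPTP Λ₀) (h₁ : IsCPTP Λ₁) (h : IsSimulation IsCPTP c Λ₀ Λ₁) {n : ℕ} (hn : 1 ≤ n)
    {θ : Param m} (hT : MemLp (fun ω => e.T ω - θ) 2 (e.law Λ₀ n)) (w : Param m) :
    (⟪w, e.expectation Λ₁ n⟫_ℝ - ⟪w, e.expectation Λ₀ n⟫_ℝ) ^ 2 ≤
      (c ^ n - 1) * ∫ ω, ⟪w, e.T ω - θ⟫_ℝ ^ 2 ∂(e.law Λ₀ n) := by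
  have := e.isProbabilityMeasure_law h₀ n
  have hsim := e.isSimulation_output h hn
  have hle := hsim.sq_integral_sub_le e.M (hT.const_inner w)
  have hexp₀ := e.integral_inner_sub h₀ (hT.integrable one_le_two) w
  have hexp₁ := e.integral_inner_sub h₁ (hsim.integrable_outcomeMeasure e.M hT) w
  rw [law] at hexp₀ hexp₁
  rwa [hexp₀, hexp₁, sub_sub_sub_cancel_right] at hle

theorem sq_deriv_inner_expectation_le (e : Estimator H H' m) {Γ Γ' : ℝ → Superoperator H H'}
    {δ : ℝ} (hδ : 0 < δ) (hΓ : ∀ᶠ s in 𝓝[≥] 0, HasInteriorTangentAt Γ (Γ' s) δ s) {n : ℕ}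
    (hn : 1 ≤ n) {θ : Param m} (hT : MemLp (fun ω => e.T ω - θ) 2 (e.law (Γ 0) n)) {w : Param m}
    {b : ℝ} (hb : HasDerivAt (fun s => ⟪w, e.expectation (Γ s) n⟫_ℝ) b 0) :
    b ^ 2 ≤ n / δ ^ 2 * ∫ ω, ⟪w, e.T ω - θ⟫_ℝ ^ 2 ∂(e.law (Γ 0) n) := by
  obtain ⟨η, hη, hsub⟩ := mem_nhdsGE_iff_exists_Icc_subset.1 hΓ
  have hsmall : ∀ᶠ t in 𝓝[>] (0 : ℝ), Real.exp (t / δ) - 1 < 1 := by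
    have hcont : Continuous fun t => Real.exp (t / δ) - 1 := by fun_prop
    exact ((hcont.tendsto 0).mono_left nhdsWithin_le_nhds).eventually_lt_const (by simp)
  have hlim := (((tendsto_one_add_sq_pow_sub_one_div_sq δ n).mono_left
    (nhdsGT_le_nhdsNE 0)).mul_const (∫ ω, ⟪w, e.T ω - θ⟫_ℝ ^ 2 ∂(e.law (Γ 0) n))).congr
    fun t => (mul_div_right_comm _ _ _).symm
  refine sq_deriv_le_of_tendsto hb ?_ hlim
  filter_upwards [hsmall, Ioo_mem_nhdsGT hη] with t ht htη
  have hseg (s) (hs : s ∈ Set.Icc 0 t) : HasInteriorTangentAt Γ (Γ' s) δ s :=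
    hsub ⟨hs.1, hs.2.trans htη.2.le⟩
  exact e.sq_inner_expectation_sub_le (hseg 0 (Set.left_mem_Icc.2 htη.1.le)).isCPTP
    (hseg t (Set.right_mem_Icc.2 htη.1.le)).isCPTP
    (isSimulation_of_hasInteriorTangentAt hδ htη.1 ht.le hseg) hn hT w

end Estimator

end CramerRao

section Cost

open Matrix

open scoped MatrixOrder in
theorem exists_sq_inner_le_dotProduct_mulVec {ι : Type*} [Fintype ι] {G : Matrix ι ι ℝ}
    (hG : G.PosSemidef) (hG0 : G ≠ 0) :
    ∃ w : EuclideanSpace ℝ ι, w ≠ 0 ∧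
      ∀ x : EuclideanSpace ℝ ι, ⟪w, x⟫_ℝ ^ 2 ≤ x.ofLp ⬝ᵥ G *ᵥ x.ofLp := by
  classical
  obtain ⟨C, rfl⟩ : ∃ C : Matrix ι ι ℝ, G = Cᴴ * C :=
    CStarAlgebra.nonneg_iff_eq_star_mul_self.1 hG.nonneg
  obtain ⟨a, hCa⟩ : ∃ a, C a ≠ 0 := by
    by_contra! hC
    exact hG0 (by rw [show C = 0 from funext hC, Matrix.mul_zero])
  refine ⟨WithLp.toLp 2 (C a), by simpa using hCa, fun x => ?_⟩
  have hinner : ⟪WithLp.toLp 2 (C a), x⟫_ℝ = (C *ᵥ x.ofLp) a := by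
    simp [PiLp.inner_apply, mulVec, dotProduct, mul_comm]
  calc ⟪WithLp.toLp 2 (C a), x⟫_ℝ ^ 2 ≤ ∑ k, (C *ᵥ x.ofLp) k ^ 2 := by
        rw [hinner]
        exact Finset.single_le_sum (f := fun k => (C *ᵥ x.ofLp) k ^ 2) (fun k _ => sq_nonneg _)
          (Finset.mem_univ a)
    _ = x.ofLp ⬝ᵥ (Cᴴ * C) *ᵥ x.ofLp := by
        rw [← mulVec_mulVec, dotProduct_mulVec, conjTranspose_eq_transpose_of_trivial,
          vecMul_transpose]
        simp only [dotProduct, sq]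

variable {H : Type*} [NormedAddCommGroup H] [InnerProductSpace ℂ H] [CompleteSpace H]
variable {H' : Type*} [NormedAddCommGroup H'] [InnerProductSpace ℂ H'] [CompleteSpace H']
variable {m : ℕ}

theorem Estimator.integrable_and_integral_dotProduct_mulVec (e : Estimator H H' m)
    {Λ : Superoperator H H'} {θ : Param m} {n : ℕ} (hT : MemLp (fun ω => e.T ω - θ) 2 (e.law Λ n))
    (G : Matrix (Fin m) (Fin m) ℝ) :
    Integrable (fun ω => (e.T ω - θ).ofLp ⬝ᵥ G *ᵥ (e.T ω - θ).ofLp) (e.law Λ n) ∧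
      ∫ ω, (e.T ω - θ).ofLp ⬝ᵥ G *ᵥ (e.T ω - θ).ofLp ∂(e.law Λ n) = (G * e.mse Λ θ n).trace := by
  have hcoord (i) : MemLp (fun ω => e.T ω i - θ i) 2 (e.law Λ n) := MemLp.eval_piLp hT i
  have hint (i k) : Integrable (fun ω => G i k * ((e.T ω k - θ k) * (e.T ω i - θ i)))
      (e.law Λ n) := ((hcoord k).integrable_mul (hcoord i)).const_mul (G i k)
  have hexpand (ω) : (e.T ω - θ).ofLp ⬝ᵥ G *ᵥ (e.T ω - θ).ofLp =
      ∑ i, ∑ k, G i k * ((e.T ω k - θ k) * (e.T ω i - θ i)) := by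
    simp only [dotProduct, mulVec, Finset.mul_sum, PiLp.sub_apply]
    exact Finset.sum_congr rfl fun i _ => Finset.sum_congr rfl fun k _ => by ring
  simp only [hexpand]
  refine ⟨integrable_finsetSum _ fun i _ => integrable_finsetSum _ fun k _ => hint i k, ?_⟩
  rw [integral_finsetSum _ fun i _ => integrable_finsetSum _ fun k _ => hint i k]
  refine Finset.sum_congr rfl fun i _ => ?_
  rw [integral_finsetSum _ fun k _ => hint i k]
  exact Finset.sum_congr rfl fun k _ => integral_const_mul _ _

theorem Estimator.integral_sq_inner_le_trace (e : Estimator H H' m) {Λ : Superoperator H H'}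
    {θ : Param m} {n : ℕ} (hT : MemLp (fun ω => e.T ω - θ) 2 (e.law Λ n))
    {G : Matrix (Fin m) (Fin m) ℝ} {w : Param m}
    (hw : ∀ x : Param m, ⟪w, x⟫_ℝ ^ 2 ≤ x.ofLp ⬝ᵥ G *ᵥ x.ofLp) :
    ∫ ω, ⟪w, e.T ω - θ⟫_ℝ ^ 2 ∂(e.law Λ n) ≤ (G * e.mse Λ θ n).trace := by
  obtain ⟨hint, htrace⟩ := e.integrable_and_integral_dotProduct_mulVec hT G
  rw [← htrace]
  exact integral_mono (hT.const_inner w).integrable_sq hint fun ω => hw _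

theorem hasDerivAt_inner_of_hasLineDerivAt {f : Param m → Param m} {b : Fin m → ℝ}
    {θ v : Param m} (h : ∀ i, HasLineDerivAt ℝ (fun θ' => f θ' i) (b i) θ v) (w : Param m) :
    HasDerivAt (fun s : ℝ => ⟪w, f (θ + s • v)⟫_ℝ) (w.ofLp ⬝ᵥ b) 0 := by
  have hcoord (i) : HasDerivAt (fun s : ℝ => f (θ + s • v) i) (b i) 0 := h i
  have hsum := HasDerivAt.fun_sum (u := Finset.univ) fun i _ => (hcoord i).const_mul (w i)
  simpa [PiLp.inner_apply, dotProduct, mul_comm] using hsum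

/-- The consequences of admissibility at the single parameter `θ`: the estimates have a finite
second moment under `Λ θ`, and the Jacobian matrix of `E[T_n]` at `θ` tends to the identity. -/
structure AsymptoticallyLocallyUnbiasedAt (Λ : Param m → Superoperator H H') (θ : Param m)
    (e : ℕ → Estimator H H' m) : Prop where
  memLp : ∀ n ≥ 1, MemLp (fun ω => (e n).T ω - θ) 2 ((e n).law (Λ θ) n)
  exists_jacobian : ∃ B : ℕ → Matrix (Fin m) (Fin m) ℝ,
    (∀ n ≥ 1, ∀ i j, HasLineDerivAt ℝ (fun θ' => (e n).expectation (Λ θ') n i) (B n i j) θ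
      (EuclideanSpace.single j (1 : ℝ))) ∧ Tendsto B atTop (𝓝 1)

theorem memLp_two_of_lintegral_lt_top {α F : Type*} [MeasurableSpace α] [NormedAddCommGroup F]
    {μ : Measure α} {f : α → F} (hf : AEStronglyMeasurable f μ) (h : ∫⁻ a, ‖f a‖ₑ ^ 2 ∂μ < ∞) :
    MemLp f 2 μ := by
  refine ⟨hf, ?_⟩
  rw [eLpNorm_lt_top_iff_lintegral_rpow_enorm_lt_top (by norm_num) (by norm_num)]
  simpa using h

variable {Θ : Set (Param m)} {Λ : Param m → Superoperator H H'}
  {dΛ : Fin m → Param m → Superoperator H H'} {θ : Param m}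

theorem Admissible.asymptoticallyLocallyUnbiasedAt {a₁ : ℝ≥0} {e : ℕ → Estimator H H' m}
    (he : Admissible Θ Λ dΛ a₁ e) (hθ : θ ∈ Θ) : AsymptoticallyLocallyUnbiasedAt Λ θ e where
  memLp n hn := by
    obtain ⟨S, -, hS⟩ := he.2
    obtain ⟨a₄, ha₄⟩ := hS n hn
    exact memLp_two_of_lintegral_lt_top ((e n).measurable.sub_const θ).aestronglyMeasurable
      ((ha₄ θ hθ).2.trans_lt (ENNReal.mul_lt_top (by simp) (by simp)))
  exists_jacobian := (he.1 θ hθ).2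

theorem eventually_hasInteriorTangentAt (hΘ : Θ ∈ 𝓝 θ) (hΛ : ∀ θ' ∈ Θ, IsCPTP (Λ θ'))
    (hderiv : ∀ i, ∀ θ' ∈ Θ, HasPartialDerivAt Λ i (dΛ i θ') θ') {ε δ : ℝ}
    (hpos : ∀ u : Param m, ‖u‖ < ε → ∀ θ' ∈ Θ,
      IsCompletelyPositive (Λ θ' + ∑ i, ((u i : ℝ) : ℂ) • dΛ i θ')) (hδ : δ < ε) (j : Fin m) :
    ∀ᶠ s in 𝓝 (0 : ℝ), HasInteriorTangentAt
      (fun s => Λ (θ + s • EuclideanSpace.single j (1 : ℝ)))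
      (dΛ j (θ + s • EuclideanSpace.single j (1 : ℝ))) δ s := by
  have hcont : Continuous fun s : ℝ => θ + s • EuclideanSpace.single j (1 : ℝ) := by fun_prop
  filter_upwards [hcont.tendsto 0 (by simpa using hΘ)] with s hs
  refine ⟨hΛ _ hs, (hderiv j _ hs).hasCbDerivAt, fun r hr => ?_⟩
  have hcp := hpos (EuclideanSpace.single j r) (by simpa using hr.trans_lt hδ) _ hs
  rwa [Finset.sum_eq_single j (fun i _ hi => by simp [hi]) (by simp), PiLp.single_apply,
    if_pos rfl] at hcp

theorem eventually_le_mul_trace_mse {e : ℕ → Estimator H H' m}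
    (he : AsymptoticallyLocallyUnbiasedAt Λ θ e) {G : Matrix (Fin m) (Fin m) ℝ} {w : Param m}
    (hw : ∀ x : Param m, ⟪w, x⟫_ℝ ^ 2 ≤ x.ofLp ⬝ᵥ G *ᵥ x.ofLp) {j : Fin m} (hwj : w j ≠ 0)
    {Γ' : ℝ → Superoperator H H'} {δ : ℝ} (hδ : 0 < δ)
    (hΓ : ∀ᶠ s in 𝓝[≥] (0 : ℝ), HasInteriorTangentAt
      (fun s => Λ (θ + s • EuclideanSpace.single j (1 : ℝ))) (Γ' s) δ s) :
    ∀ᶠ n : ℕ in atTop, δ ^ 2 * (w j ^ 2 / 2) ≤ n * (G * (e n).mse (Λ θ) θ n).trace := by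
  obtain ⟨B, hB, hBlim⟩ := he.exists_jacobian
  have hslope : Tendsto (fun n => (w.ofLp ⬝ᵥ fun i => B n i j) ^ 2) atTop (𝓝 (w j ^ 2)) := by
    have hcont : Continuous fun A : Matrix (Fin m) (Fin m) ℝ => (w.ofLp ⬝ᵥ fun i => A i j) ^ 2 := by
      fun_prop
    simpa [Function.comp_def, dotProduct, Matrix.one_apply] using (hcont.tendsto 1).comp hBlim
  filter_upwards [hslope.eventually (eventually_ge_nhds (half_lt_self (by positivity))),
    eventually_ge_atTop 1] with n hhalf hn
  have hT : MemLp (fun ω => (e n).T ω - θ) 2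
      ((e n).law (Λ (θ + (0 : ℝ) • EuclideanSpace.single j (1 : ℝ))) n) := by
    simpa using he.memLp n hn
  have hbound := Estimator.sq_deriv_inner_expectation_le (e n) hδ hΓ hn hT
    (hasDerivAt_inner_of_hasLineDerivAt (fun i => hB n hn i j) w)
  rw [zero_smul, add_zero] at hbound
  calc δ ^ 2 * (w j ^ 2 / 2) ≤ δ ^ 2 * (w.ofLp ⬝ᵥ fun i => B n i j) ^ 2 := by gcongr
    _ ≤ δ ^ 2 * (n / δ ^ 2 * ∫ ω, ⟪w, (e n).T ω - θ⟫_ℝ ^ 2 ∂((e n).law (Λ θ) n)) := by gcongr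
    _ = n * ∫ ω, ⟪w, (e n).T ω - θ⟫_ℝ ^ 2 ∂((e n).law (Λ θ) n) := by field_simp
    _ ≤ n * (G * (e n).mse (Λ θ) θ n).trace := by
        gcongr
        exact (e n).integral_sq_inner_le_trace (he.memLp n hn) hw

theorem asymptoticCost_ne_zero {a₁ : ℝ≥0} {G : Matrix (Fin m) (Fin m) ℝ} {c : ℝ} (hc : 0 < c)
    (h : ∀ e : ℕ → Estimator H H' m, Admissible Θ Λ dΛ a₁ e →
      ∀ᶠ n : ℕ in atTop, c ≤ n * (G * (e n).mse (Λ θ) θ n).trace) :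
    asymptoticCost Θ Λ dΛ a₁ G θ ≠ 0 := by
  have hle : ENNReal.ofReal c ≤ asymptoticCost Θ Λ dΛ a₁ G θ :=
    le_iInf₂ fun e he => le_limsup_of_frequently_le'
      ((h e he).mono fun n hn => ENNReal.ofReal_le_ofReal hn).frequently
  exact ((ENNReal.ofReal_pos.2 hc).trans_le hle).ne'

theorem not_isBigO_one_div_sq {a : ℕ → ℝ} {c : ℝ} (hc : 0 < c)
    (h : ∀ᶠ n : ℕ in atTop, c ≤ n * a n) : ¬ a =O[atTop] fun n : ℕ => 1 / (n : ℝ) ^ 2 := by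
  intro hO
  have hlim : Tendsto (fun n : ℕ => n * a n) atTop (𝓝 0) := by
    refine (((Asymptotics.isBigO_refl (fun n : ℕ => (n : ℝ)) atTop).mul hO).congr_right
      fun n => ?_).trans_tendsto tendsto_one_div_atTop_nhds_zero_nat
    rcases eq_or_ne (n : ℝ) 0 with hn | hn
    · simp [hn]
    · field_simp
  exact hc.not_ge (ge_of_tendsto hlim h)

end Cost

end QuantumEstimation

theorem mainTheorem6_general
    {H H' : Type*}
    [NormedAddCommGroup H] [InnerProductSpace ℂ H] [CompleteSpace H]
    [NormedAddCommGroup H'] [InnerProductSpace ℂ H'] [CompleteSpace H']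
    {m : ℕ} {Θ : Set (QuantumEstimation.Param m)} {θ : QuantumEstimation.Param m} (hΘ : Θ ∈ 𝓝 θ)
    {Λ : QuantumEstimation.Param m → QuantumEstimation.Superoperator H H'}
    (hΛ : ∀ θ' ∈ Θ, QuantumEstimation.IsCPTP (Λ θ'))
    {dΛ : Fin m → QuantumEstimation.Param m → QuantumEstimation.Superoperator H H'}
    (hderiv : ∀ i, ∀ θ' ∈ Θ, QuantumEstimation.HasPartialDerivAt Λ i (dΛ i θ') θ')
    (hint : ∃ ε > 0, ∀ u : QuantumEstimation.Param m, ‖u‖ < ε → ∀ θ' ∈ Θ,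
      QuantumEstimation.IsCompletelyPositive (Λ θ' + ∑ i, ((u i : ℝ) : ℂ) • dΛ i θ'))
    {G : Matrix (Fin m) (Fin m) ℝ} (hG : G.PosSemidef) (hG0 : G ≠ 0) :
    ∃ c > 0, ∀ e : ℕ → QuantumEstimation.Estimator H H' m,
      QuantumEstimation.AsymptoticallyLocallyUnbiasedAt Λ θ e →
      ∀ᶠ n : ℕ in atTop, c ≤ n * (G * (e n).mse (Λ θ) θ n).trace := by
  obtain ⟨ε, hε, hpos⟩ := hint
  obtain ⟨w, hw0, hw⟩ := QuantumEstimation.exists_sq_inner_le_dotProduct_mulVec hG hG0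
  obtain ⟨j, hwj⟩ : ∃ j, w j ≠ 0 := by
    by_contra! h
    exact hw0 (PiLp.ext h)
  have hΓ := QuantumEstimation.eventually_hasInteriorTangentAt hΘ hΛ hderiv hpos
    (half_lt_self hε) j
  exact ⟨(ε / 2) ^ 2 * (w j ^ 2 / 2), by positivity, fun e he =>
    QuantumEstimation.eventually_le_mul_trace_mse he hw hwj (half_pos hε)
      (hΓ.filter_mono nhdsWithin_le_nhds)⟩

theorem mainTheorem6
    {H H' : Type*}
    [NormedAddCommGroup H] [InnerProductSpace ℂ H] [CompleteSpace H]
    [TopologicalSpace.SeparableSpace H]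
    [NormedAddCommGroup H'] [InnerProductSpace ℂ H'] [CompleteSpace H']
    [TopologicalSpace.SeparableSpace H']
    {m : ℕ} (Θ : Set (QuantumEstimation.Param m)) (hΘ : IsOpen Θ)
    (Λ : QuantumEstimation.Param m → QuantumEstimation.Superoperator H H')
    (hΛ : ∀ θ ∈ Θ, QuantumEstimation.IsCPTP (Λ θ))
    (dΛ : Fin m → QuantumEstimation.Param m → QuantumEstimation.Superoperator H H')
    (ddΛ : Fin m → Fin m → QuantumEstimation.Param m → QuantumEstimation.Superoperator H H')
    (a₁ : ℝ≥0) (hreg : QuantumEstimation.RegularModel Θ Λ dΛ ddΛ a₁)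
    (hint : ∃ ε > 0, ∀ u : QuantumEstimation.Param m, ‖u‖ < ε → ∀ θ ∈ Θ,
      QuantumEstimation.IsCompletelyPositive (Λ θ + ∑ i, ((u i : ℝ) : ℂ) • dΛ i θ))
    (θ : QuantumEstimation.Param m) (hθ : θ ∈ Θ)
    (G : Matrix (Fin m) (Fin m) ℝ) (hG : G.PosSemidef) (hG0 : G ≠ 0) :
    QuantumEstimation.asymptoticCost Θ Λ dΛ a₁ G θ ≠ 0 ∧
    ∀ e : ℕ → QuantumEstimation.Estimator H H' m,
      QuantumEstimation.Admissible Θ Λ dΛ a₁ e →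
      ¬ ((fun n : ℕ => (G * (e n).mse (Λ θ) θ n).trace) =O[atTop]
        fun n : ℕ => 1 / (n : ℝ) ^ 2) := by
  obtain ⟨c, hc, hle⟩ := mainTheorem6_general (hΘ.mem_nhds hθ) hΛ hreg.hasDeriv hint hG hG0
  exact ⟨QuantumEstimation.asymptoticCost_ne_zero hc fun e he =>
      hle e (he.asymptoticallyLocallyUnbiasedAt hθ),
    fun e he => QuantumEstimation.not_isBigO_one_div_sq hc
      (hle e (he.asymptoticallyLocallyUnbiasedAt hθ))⟩
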